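/- Let $d\ge 4$. For a surface $X=\{F=0\}\subset\mathbb{CP}^3$ of degree $d$ (with $F\neq 0$ a form of degree $d$) and a line $L\not\subset X$, let $\alpha(L\cap X)$ be the partition of $d$ formed by the multiplicities, in decreasing order, of the zero-dimensional scheme $L\cap X$ at its points. Let $G(2,4)$ be the Grassmannian of lines of $\mathbb{CP}^3$, with its Zariski topology. There is a non-empty Zariski open subset $U$ of the projective space of all surfaces of degree $d$ such that every $X\in U$ contains no line and, for every $L\in G(2,4)$, the partition $\alpha(L\cap X)$ is one of the following (those among them that are partitions of $d$): - $(1,\dots,1)$, and the set of lines where it occurs is a non-empty Zariski open subset of $G(2,4)$; - $(2,1,\dots,1)$, and the set of lines where it occurs is a locally closed hypersurface of $G(2,4)$ (all its irreducible components have dimension $3$); - $(2,2,1,\dots,1)$ or $(3,1,\dots,1)$, and the set of lines where each of these occurs is a locally closed subvariety of $G(2,4)$ of dimension $2$; - $(2,2,2,1,\dots,1)$, $(3,2,1,\dots,1)$ or $(4,1,\dots,1)$, and the set of lines where each of these occurs is a locally closed subvariety of $G(2,4)$ of dimension $1$; - $(2,2,2,2,1,\dots,1)$, $(3,2,2,1,\dots,1)$,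 $(3,3,1,\dots,1)$, $(4,2,1,\dots,1)$ or $(5,1,\dots,1)$, and the set of lines where each of these occurs is finite. Apart from the first one, these sets are allowed to be empty. -/

import Mathlib

open scoped LinearAlgebra.Projectivization

noncomputable section

/-- The projective space of all surfaces of degree `d` in `ℂℙ³`: nonzero quaternary forms of
degree `d` up to a scalar. -/
def Surface (d : ℕ) : Type :=
  ℙ ℂ (MvPolynomial.homogeneousSubmodule (Fin 4) ℂ d)

/-- The Grassmannian `G(2,4)`: the lines of `ℂℙ³`, as planes of `ℂ⁴`. -/
def ProjLine : Type :=
  {L : Submodule ℂ (Fin 4 → ℂ) // Module.finrank ℂ L = 2}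

/-- A form defining the surface (unique up to a nonzero scalar). -/
def Surface.form {d : ℕ} (X : Surface d) : MvPolynomial (Fin 4) ℂ :=
  (Projectivization.rep X : MvPolynomial.homogeneousSubmodule (Fin 4) ℂ d).1

/-- The Zariski topology on the projective space of surfaces of degree `d`. Its basic open sets are
the nonvanishing loci of homogeneous polynomials in the coefficients of the form. -/
instance Surface.zariski (d : ℕ) : TopologicalSpace (Surface d) :=
  TopologicalSpace.generateFrom
    {U | ∃ (k : ℕ) (P : MvPolynomial (Fin 4 →₀ ℕ) ℂ), P.IsHomogeneous k ∧
      U = {X | MvPolynomial.eval (fun m => X.form.coeff m) P ≠ 0}}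

/-- The Plücker coordinates of the pair `(u, v)`. -/
def pluecker (u v : Fin 4 → ℂ) (ij : Fin 4 × Fin 4) : ℂ :=
  u ij.1 * v ij.2 - u ij.2 * v ij.1

/-- The Zariski topology on `G(2,4)`. Its basic open sets are the nonvanishing loci of homogeneous
polynomials in the Plücker coordinates (which are defined by the line up to a nonzero scalar). -/
instance ProjLine.zariski : TopologicalSpace ProjLine :=
  TopologicalSpace.generateFrom
    {U | ∃ (k : ℕ) (P : MvPolynomial (Fin 4 × Fin 4) ℂ), P.IsHomogeneous k ∧
      U = {L | ∃ u v : Fin 4 → ℂ, Submodule.span ℂ {u, v} = L.1 ∧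
        MvPolynomial.eval (pluecker u v) P ≠ 0}}

/-- The line `L` is contained in the surface `X`. -/
def Surface.ContainsLine {d : ℕ} (X : Surface d) (L : ProjLine) : Prop :=
  ∀ v ∈ L.1, MvPolynomial.eval v X.form = 0

/-- The set of points of `ℂℙ³` that lie on both `L` and `X`. -/
def Surface.inter {d : ℕ} (X : Surface d) (L : ProjLine) : Set (ℙ ℂ (Fin 4 → ℂ)) :=
  {q | q.submodule ≤ L.1 ∧ MvPolynomial.eval q.rep X.form = 0}

/-- The polynomial `F (a + t b)` in the variable `t`. -/
def alongLine (F : MvPolynomial (Fin 4) ℂ) (a b : Fin 4 → ℂ) : Polynomial ℂ :=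
  MvPolynomial.aeval (fun i => Polynomial.C (a i) + Polynomial.C (b i) * Polynomial.X) F

/-- The multiplicity of the scheme `L ∩ X` at the point `q = [a]` of `L`: the order at `t = 0` of
`F (a + t b)`, where `F` is a form defining `X` and `a`, `b` span `L`. All such `b` give the same
order, so the infimum is over a one-point set. -/
def Surface.interMult {d : ℕ} (X : Surface d) (L : ProjLine) (q : ℙ ℂ (Fin 4 → ℂ)) : ℕ :=
  sInf {m | ∃ b ∈ L.1, b ∉ q.submodule ∧ m = (alongLine X.form q.rep b).rootMultiplicity 0}

/-- The partition `α(L ∩ X)`: the multiset of the multiplicities of `L ∩ X` at its points (for `L`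
not contained in `X`, so that there are finitely many points). -/
def Surface.interPartition {d : ℕ} (X : Surface d) (L : ProjLine) : Multiset ℕ :=
  ∑ᶠ q ∈ X.inter L, ({X.interMult L q} : Multiset ℕ)

/-- The partition `(s, 1, …, 1)` of `d`. If the parts in `s` add up to more than `d`, this is not a
partition of `d`, and no line has it. -/
def withOnes (d : ℕ) (s : Multiset ℕ) : Multiset ℕ :=
  s + Multiset.replicate (d - s.sum) 1

/-- The set of lines `L` with `α(L ∩ X) = (s, 1, …, 1)`. -/
def Surface.stratum {d : ℕ} (X : Surface d) (s : Multiset ℕ) : Set ProjLine :=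
  {L | X.interPartition L = withOnes d s}

/-- A locally closed hypersurface of `G(2,4)` (possibly empty): a locally closed set all of whose
irreducible components have dimension `3 = dim G(2,4) - 1`. -/
def IsLocallyClosedHypersurface (T : Set ProjLine) : Prop :=
  IsLocallyClosed T ∧ ∀ Z ∈ irreducibleComponents T, topologicalKrullDim Z = 3

/-- A locally closed subvariety of `G(2,4)` that is empty or of dimension `n`. -/
def IsLocallyClosedOfDim (T : Set ProjLine) (n : ℕ) : Prop :=
  IsLocallyClosed T ∧ (T.Nonempty → topologicalKrullDim T = n)

end

/-! If `L ∩ X` has `k` points and its partition is `(s, 1, …, 1)`, then `d - k = s.sum - s.card`.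
This defect is the expected codimension of the stratum, and the partitions in the theorem are
exactly those of defect at most `4`. Each stratum is bounded in dimension from both sides, by two
independent arguments carried out in the affine charts of the Grassmannian.

Lower bound and local closedness, for any `X` without lines. In a chart, the form restricts to a
polynomial in `t` whose coefficients are polynomials in the four coordinates of the line. Where its
coefficient in degree `d` is nonzero, having the shape `a ∏ (t - r i) ^ μ i` with `k` factors
amounts to `d` equations in the `4 + k` unknowns formed by the line and the rescaled roots. The
roots are integral over the chart (`coverMap_rootEquations_isIntegral`), so the projection to the
chart is finite. Its image is therefore closed, and by Krull's height theorem it has dimension at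
least `4 + k - d` near each of its points (`AffFour.le_topologicalKrullDim_coverImage`). On the open
set of lines with at least `k` points, these images cut out the stratum (`stratum_local`).

Upper bound, for generic `X`. Pairs of a line and a form whose restriction has at most `k` roots are
parametrized by `4` coordinates of the line, the coefficients of the form off the line, and at most
`k + 1` numbers for the restriction. If `N` is the number of coefficients of a form, this makes at
most `4 + (N - d - 1) + (k + 1)` parameters. So as soon as `p > 4 + k - d`, any `p` coordinates of
the line and the `N` coefficients are algebraically dependent (`exists_relation`). For generic
coefficients the relation stays nontrivial in the `p` coordinates, which bounds the dimension by `p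
- 1` (`AffFour.topologicalKrullDim_le_of_relations`). The case `p = 0` excludes defects above `4`,
`p = 1` gives finiteness, and `p = 4` shows that some line meets `X` in `d` points. -/

open MvPolynomial Topology TopologicalSpace

/-- Affine `4`-space over `ℂ`, with its Zariski topology. -/
@[ext]
structure AffFour where
  /-- The coordinates of a point. -/
  coord : Fin 4 → ℂ

/-! ### The Zariski topology on the closed points of affine four-space -/

namespace AffFour

/-- The closed point of the prime spectrum attached to a point of affine space. -/
noncomputable def toSpec (x : AffFour) : PrimeSpectrum (MvPolynomial (Fin 4) ℂ) :=
  pointToPoint (k := ℂ) (K := ℂ) x.coord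

noncomputable instance : TopologicalSpace AffFour := TopologicalSpace.induced toSpec inferInstance

theorem isInducing_toSpec : IsInducing toSpec := ⟨rfl⟩

/-- The evaluation of a polynomial at a point of affine space. -/
noncomputable def ev (x : AffFour) : MvPolynomial (Fin 4) ℂ →+* ℂ := MvPolynomial.eval x.coord

theorem mem_toSpec {x : AffFour} {p : MvPolynomial (Fin 4) ℂ} :
    p ∈ (toSpec x).asIdeal ↔ ev x p = 0 := by
  simp only [toSpec, pointToPoint, mem_vanishingIdeal_singleton_iff, ev, MvPolynomial.aeval_eq_eval]

instance : NoetherianSpace AffFour := isInducing_toSpec.noetherianSpace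

/-- The zero locus of an ideal in affine space. -/
def zeros (I : Ideal (MvPolynomial (Fin 4) ℂ)) : Set AffFour := {x | ∀ p ∈ I, ev x p = 0}

theorem isClosed_zeros (I : Ideal (MvPolynomial (Fin 4) ℂ)) : IsClosed (zeros I) := by
  have : zeros I = toSpec ⁻¹' PrimeSpectrum.zeroLocus (I : Set (MvPolynomial (Fin 4) ℂ)) := by
    ext x
    simp only [zeros, Set.mem_ofPred_eq, Set.mem_preimage, PrimeSpectrum.mem_zeroLocus]
    exact ⟨fun h p hp => mem_toSpec.2 (h p hp), fun h p hp => mem_toSpec.1 (h hp)⟩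
  rw [this]
  exact (PrimeSpectrum.isClosed_zeroLocus _).preimage isInducing_toSpec.continuous

theorem isOpen_ne_zero (p : MvPolynomial (Fin 4) ℂ) : IsOpen {x : AffFour | ev x p ≠ 0} := by
  have : {x : AffFour | ev x p ≠ 0} = toSpec ⁻¹' (PrimeSpectrum.basicOpen p : Set _) := by
    ext x
    simp only [Set.mem_ofPred_eq, Set.mem_preimage, SetLike.mem_coe, PrimeSpectrum.mem_basicOpen]
    exact not_congr mem_toSpec.symm
  rw [this]
  exact (PrimeSpectrum.basicOpen p).isOpen.preimage isInducing_toSpec.continuous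

theorem exists_basic {O : Set AffFour} (hO : IsOpen O) {x : AffFour} (hx : x ∈ O) :
    ∃ h : MvPolynomial (Fin 4) ℂ, ev x h ≠ 0 ∧ {y : AffFour | ev y h ≠ 0} ⊆ O := by
  obtain ⟨V, hV, rfl⟩ := isInducing_toSpec.isOpen_iff.1 hO
  obtain ⟨_, ⟨h, rfl⟩, hxh, hh⟩ :=
    PrimeSpectrum.isTopologicalBasis_basic_opens.exists_subset_of_mem_open hx hV
  refine ⟨h, fun h0 => hxh (mem_toSpec.2 h0), fun y hy => hh fun h0 => hy (mem_toSpec.1 h0)⟩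

/-- The Nullstellensatz for a prime ideal, which is its own radical. -/
theorem mem_of_forall_zeros {P : Ideal (MvPolynomial (Fin 4) ℂ)} [P.IsPrime]
    {g : MvPolynomial (Fin 4) ℂ} (hg : ∀ x ∈ zeros P, ev x g = 0) : g ∈ P := by
  rw [← IsPrime.vanishingIdeal_zeroLocus (K := ℂ) P]
  intro x hx
  have := hg ⟨x⟩ (fun p hp => by simpa [ev, MvPolynomial.aeval_eq_eval] using hx p hp)
  simpa [ev, MvPolynomial.aeval_eq_eval] using this

theorem isPreirreducible_zeros (P : Ideal (MvPolynomial (Fin 4) ℂ)) [hP : P.IsPrime] :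
    IsPreirreducible (zeros P) := by
  rintro U V hU hV ⟨x, hxP, hxU⟩ ⟨y, hyP, hyV⟩
  obtain ⟨g, hg, hgU⟩ := exists_basic hU hxU
  obtain ⟨h, hh, hhV⟩ := exists_basic hV hyV
  by_contra hcon
  have : g * h ∈ P := by
    refine mem_of_forall_zeros fun z hz => ?_
    by_contra hne
    rw [map_mul] at hne
    exact hcon ⟨z, hz, hgU (left_ne_zero_of_mul hne), hhV (right_ne_zero_of_mul hne)⟩
  rcases hP.mem_or_mem this with h1 | h1
  · exact hg (hxP g h1)
  · exact hh (hyP h h1)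

end AffFour

/-! ### Irreducible sets and subspaces -/

theorem IsPreirreducible.preimage_val {X : Type*} [TopologicalSpace X] {T S : Set X}
    (hS : IsPreirreducible S) (hST : S ⊆ T) :
    IsPreirreducible ((↑) ⁻¹' S : Set T) := by
  rintro U V hU hV ⟨x, hxS, hxU⟩ ⟨y, hyS, hyV⟩
  obtain ⟨U, hU', rfl⟩ := isOpen_induced_iff.1 hU
  obtain ⟨V, hV', rfl⟩ := isOpen_induced_iff.1 hV
  obtain ⟨z, hz, hzU, hzV⟩ := hS U V hU' hV' ⟨x, hxS, hxU⟩ ⟨y, hyS, hyV⟩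
  exact ⟨⟨z, hST hz⟩, hz, hzU, hzV⟩

theorem IsPreirreducible.inter_isOpen {X : Type*} [TopologicalSpace X] {S O : Set X}
    (hS : IsPreirreducible S) (hO : IsOpen O) : IsPreirreducible (S ∩ O) := by
  rintro U V hU hV ⟨x, ⟨hxS, hxO⟩, hxU⟩ ⟨y, ⟨hyS, hyO⟩, hyV⟩
  obtain ⟨z, hz, ⟨hzO, hzU⟩, -, hzV⟩ := hS (O ∩ U) (O ∩ V) (hO.inter hU) (hO.inter hV)
    ⟨x, hxS, hxO, hxU⟩ ⟨y, hyS, hyO, hyV⟩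
  exact ⟨z, ⟨hz, hzO⟩, hzU, hzV⟩

/-! ### Dimension bounds in affine space -/

/-- By Noether normalization `B` is finite over a polynomial ring in `s` variables, so its dimension
is at most `s` by incomparability, and `s` is at most the transcendence degree. A transcendence
basis can be chosen among the generators, so `s > m` would give `m + 1` independent generators. -/
theorem ringKrullDim_le_of_relations {B : Type} [CommRing B] [IsDomain B] [Algebra ℂ B] {n m : ℕ}
    (x : Fin n → B) (hx : Algebra.adjoin ℂ (Set.range x) = ⊤)
    (h : ∀ ι : Fin (m + 1) → Fin n, Function.Injective ι → ¬ AlgebraicIndependent ℂ (x ∘ ι)) :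
    ringKrullDim B ≤ m := by
  have hft : Algebra.FiniteType ℂ B :=
    ⟨⟨(Set.finite_range x).toFinset, by simpa using hx⟩⟩
  obtain ⟨s, g, hginj, hgfin⟩ := exists_finite_inj_algHom_of_fg ℂ B
  have h1 : ringKrullDim B ≤ s := by
    have h2 : ringKrullDim (MvPolynomial (Fin s) ℂ) = s := by simp
    rw [← h2]
    algebraize [g.toRingHom]
    have : Algebra.IsIntegral (MvPolynomial (Fin s) ℂ) B := ⟨hgfin.to_isIntegral⟩
    refine Order.krullDim_le_of_strictMono (PrimeSpectrum.comap g.toRingHom) fun P Q hPQ => ?_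
    exact Ideal.IsIntegral.comap_lt_comap (R := MvPolynomial (Fin s) ℂ) hPQ
  refine h1.trans ?_
  have hs : AlgebraicIndependent ℂ (g ∘ (X : Fin s → MvPolynomial (Fin s) ℂ)) :=
    (MvPolynomial.algebraicIndependent_X (Fin s) ℂ).map' hginj
  have halg : Algebra.IsAlgebraic (Algebra.adjoin ℂ (Set.range x)) B := by
    rw [hx]
    exact ⟨fun b => isAlgebraic_algebraMap (⟨b, trivial⟩ : (⊤ : Subalgebra ℂ B))⟩
  obtain ⟨t, htx, ht⟩ := exists_isTranscendenceBasis_subset (R := ℂ) (Set.range x)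
  have hcard : (s : Cardinal) ≤ Cardinal.mk t := by
    rw [ht.cardinalMk_eq_trdeg]
    simpa using hs.cardinalMk_le_trdeg
  have htfin : t.Finite := (Set.finite_range x).subset htx
  by_contra hlt
  have hlt : m + 1 ≤ s := by
    by_contra h3
    exact hlt (by exact_mod_cast (by omega : s ≤ m))
  have : Fintype t := htfin.fintype
  have hcard' : s ≤ Fintype.card t := by simpa using hcard
  obtain ⟨e⟩ : Nonempty (Fin (m + 1) ↪ t) :=
    Function.Embedding.nonempty_of_card_le (by simpa using hlt.trans hcard')
  choose f hf using fun b : t => htx b.2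
  have hcomp : x ∘ (f ∘ e) = ((↑) : t → B) ∘ e := by
    ext i
    simp [hf]
  refine h (f ∘ e) ?_ ?_
  · intro i j hij
    apply e.injective
    apply Subtype.ext
    rw [← hf, ← hf]
    exact congrArg x hij
  · rw [hcomp]
    exact ht.1.comp e e.injective

namespace AffFour

/-- `T` embeds in the spectrum of the quotient by the ideal `J` of polynomials vanishing on `T`. The
relations lie in `J`, hence hold in the quotient by every prime containing `J`, and there the bound
for domains applies. -/
theorem topologicalKrullDim_le_of_relations (T : Set AffFour) (m : ℕ)
    (h : ∀ ι : Fin (m + 1) → Fin 4, Function.Injective ι → ∃ q : MvPolynomial (Fin (m + 1)) ℂ,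
      q ≠ 0 ∧ ∀ x ∈ T, ev x (rename ι q) = 0) :
    topologicalKrullDim T ≤ m := by
  let J : Ideal (MvPolynomial (Fin 4) ℂ) := ⨅ x : T, (toSpec x).asIdeal
  have hJ : ∀ x : T, toSpec x ∈ Set.range (PrimeSpectrum.comap (Ideal.Quotient.mk J)) := by
    intro x
    rw [range_comap_of_surjective _ _ Ideal.Quotient.mk_surjective, Ideal.mk_ker]
    exact iInf_le (fun x : T => (toSpec x).asIdeal) x
  choose f hf using hJ
  have hind : IsInducing f := by
    have hg := (PrimeSpectrum.isClosedEmbedding_comap_of_surjective _ (Ideal.Quotient.mk J)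
      Ideal.Quotient.mk_surjective).isInducing
    rw [← hg.of_comp_iff]
    have : PrimeSpectrum.comap (Ideal.Quotient.mk J) ∘ f = toSpec ∘ Subtype.val := funext hf
    rw [this]
    exact isInducing_toSpec.comp IsInducing.subtypeVal
  refine hind.topologicalKrullDim_le.trans ?_
  rw [PrimeSpectrum.topologicalKrullDim_eq_ringKrullDim, ringKrullDim_quotient,
    Order.krullDim_eq_iSup_coheight]
  refine iSup_le fun P => ?_
  rw [Order.coheight_eq_krullDim_Ici]
  have hle : Order.krullDim (Set.Ici P) ≤ ringKrullDim (MvPolynomial (Fin 4) ℂ ⧸ P.1.asIdeal) := by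
    rw [ringKrullDim_quotient]
    exact Order.krullDim_le_of_strictMono (fun Q => ⟨Q.1.1, Q.2⟩) fun _ _ hQ => hQ
  refine hle.trans (ringKrullDim_le_of_relations
    (fun i => Ideal.Quotient.mkₐ ℂ P.1.asIdeal (X i)) ?_ ?_)
  · rw [Set.range_comp' (Ideal.Quotient.mkₐ ℂ P.1.asIdeal), ← AlgHom.map_adjoin,
      MvPolynomial.adjoin_range_X, Algebra.map_top, AlgHom.range_eq_top]
    exact Ideal.Quotient.mkₐ_surjective ℂ _
  · intro ι hι hind
    obtain ⟨q, hq0, hq⟩ := h ι hι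
    apply hq0
    apply hind
    rw [map_zero]
    have : rename ι q ∈ P.1.asIdeal := P.2 (by
      simp only [J, Submodule.coe_iInf, Set.mem_iInter]
      exact fun x => mem_toSpec.2 (hq x x.2))
    rw [← Ideal.Quotient.eq_zero_iff_mem, ← Ideal.Quotient.mkₐ_eq_mk ℂ] at this
    rw [← this]
    rw [← AlgHom.comp_apply]
    congr 1
    ext i
    simp

/-! ### Integral covers of affine space -/

/-- Translation of the variables of a polynomial ring. -/
noncomputable def translate {κ : Type*} (c : κ → ℂ) : MvPolynomial κ ℂ ≃ₐ[ℂ] MvPolynomial κ ℂ :=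
  AlgEquiv.ofAlgHom (aeval fun i => X i + C (c i)) (aeval fun i => X i - C (c i))
    (by ext i; simp [MvPolynomial.algHom_C]) (by ext i; simp [MvPolynomial.algHom_C])

/-- Some maximal ideal has height equal to the dimension. It is the ideal of a point, and a
translation carries that point to `y`. -/
theorem height_vanishingIdeal_singleton {κ : Type} [Fintype κ] (y : κ → ℂ) :
    (vanishingIdeal ℂ {y} : Ideal (MvPolynomial κ ℂ)).height = Fintype.card κ := by
  have hdim : ringKrullDim (MvPolynomial κ ℂ) = (Fintype.card κ : ℕ) := by simp
  have : FiniteRingKrullDim (MvPolynomial κ ℂ) := by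
    rw [finiteRingKrullDim_iff_ne_bot_and_top, hdim]
    exact ⟨by simp, fun h => ENat.natCast_ne_top (Fintype.card κ) (WithBot.coe_injective h)⟩
  obtain ⟨P, hP, hPh⟩ := Ideal.exists_isMaximal_height (R := MvPolynomial κ ℂ)
  obtain ⟨z, rfl⟩ := eq_vanishingIdeal_singleton_of_isMaximal ℂ hP
  rw [hdim] at hPh
  have h1 : (vanishingIdeal ℂ {y} : Ideal (MvPolynomial κ ℂ)) =
      (vanishingIdeal ℂ {z} : Ideal (MvPolynomial κ ℂ)).comap
        (translate (fun i => y i - z i) : MvPolynomial κ ℂ ≃ₐ[ℂ] MvPolynomial κ ℂ).toRingEquiv := by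
    ext p
    rw [Ideal.mem_comap, mem_vanishingIdeal_singleton_iff, mem_vanishingIdeal_singleton_iff]
    have : (aeval z).comp (translate (fun i => y i - z i)).toAlgHom =
        (aeval y : MvPolynomial κ ℂ →ₐ[ℂ] ℂ) := by
      ext i
      simp [translate]
    rw [← this]
    rfl
  rw [h1, RingEquiv.height_comap]
  exact_mod_cast hPh

section Cover

variable {k : ℕ} (E : Finset (MvPolynomial (Fin 4 ⊕ Fin k) ℂ))

/-- The projection to affine `4`-space of the zero locus of the equations in `E`. -/
def coverImage : Set AffFour :=
  {x | ∃ r : Fin k → ℂ, ∀ e ∈ E, MvPolynomial.eval (Sum.elim x.coord r) e = 0}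

/-- The coordinate ring of affine `4`-space mapped to that of the zero locus of `E`. -/
noncomputable def coverMap : MvPolynomial (Fin 4) ℂ →+*
    MvPolynomial (Fin 4 ⊕ Fin k) ℂ ⧸ Ideal.span (E : Set (MvPolynomial (Fin 4 ⊕ Fin k) ℂ)) :=
  (Ideal.Quotient.mk _).comp (rename Sum.inl).toRingHom

theorem coverMap_isIntegral_of
    (h : ∀ i : Fin k, ∃ p : Polynomial (MvPolynomial (Fin 4) ℂ), p.Monic ∧
      p.eval₂ (coverMap E) (Ideal.Quotient.mk _ (X (Sum.inr i))) = 0) :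
    (coverMap E).IsIntegral := by
  algebraize [coverMap E]
  have hS : ∀ p : MvPolynomial (Fin 4 ⊕ Fin k) ℂ, IsIntegral (MvPolynomial (Fin 4) ℂ)
      (Ideal.Quotient.mk (Ideal.span (E : Set (MvPolynomial (Fin 4 ⊕ Fin k) ℂ))) p) := by
    intro p
    induction p using MvPolynomial.induction_on with
    | C a =>
      have : Ideal.Quotient.mk (Ideal.span (E : Set (MvPolynomial (Fin 4 ⊕ Fin k) ℂ))) (C a) =
        coverMap E (C a) := by simp [coverMap]
      rw [this]
      exact isIntegral_algebraMap (x := (C a : MvPolynomial (Fin 4) ℂ))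
    | add p q hp hq => rw [map_add]; exact hp.add hq
    | mul_X p i hp =>
      rw [map_mul]
      refine hp.mul ?_
      rcases i with i | i
      · have : Ideal.Quotient.mk (Ideal.span (E : Set (MvPolynomial (Fin 4 ⊕ Fin k) ℂ)))
          (X (Sum.inl i)) = coverMap E (X i) := by simp [coverMap]
        rw [this]
        exact isIntegral_algebraMap (x := (X i : MvPolynomial (Fin 4) ℂ))
      · exact h i
  intro s
  obtain ⟨p, rfl⟩ := Ideal.Quotient.mk_surjective s
  exact hS p

/-- Lying over: a maximal ideal containing the kernel is the contraction of a maximal ideal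
upstairs, and by the Nullstellensatz the latter is a point of the zero locus of `E`. -/
theorem coverImage_eq_zeros (h : (coverMap E).IsIntegral) :
    coverImage E = zeros (RingHom.ker (coverMap E)) := by
  ext x
  constructor
  · rintro ⟨r, hr⟩ p hp
    rw [RingHom.mem_ker, coverMap, RingHom.comp_apply, Ideal.Quotient.eq_zero_iff_mem] at hp
    have hle : Ideal.span (E : Set (MvPolynomial (Fin 4 ⊕ Fin k) ℂ)) ≤
        RingHom.ker (MvPolynomial.eval (Sum.elim x.coord r)) := Ideal.span_le.2 hr
    have := hle hp
    simpa [RingHom.mem_ker, ev, eval_rename] using this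
  · intro hx
    have hker : RingHom.ker (coverMap E) ≤ (toSpec x).asIdeal := fun p hp => mem_toSpec.2 (hx p hp)
    have hmax : (toSpec x).asIdeal.IsMaximal :=
      inferInstanceAs (vanishingIdeal ℂ {x.coord} : Ideal (MvPolynomial (Fin 4) ℂ)).IsMaximal
    algebraize [coverMap E]
    obtain ⟨Q, hQ, hQx⟩ := Ideal.exists_ideal_over_maximal_of_isIntegral
      (S := MvPolynomial (Fin 4 ⊕ Fin k) ℂ ⧸ Ideal.span (E : Set (MvPolynomial (Fin 4 ⊕ Fin k) ℂ)))
      (toSpec x).asIdeal hker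
    have hQ' : (Q.comap (Ideal.Quotient.mk _)).IsMaximal :=
      Ideal.comap_isMaximal_of_surjective _ Ideal.Quotient.mk_surjective
    obtain ⟨y, hy⟩ := eq_vanishingIdeal_singleton_of_isMaximal ℂ hQ'
    have hyx : ∀ i, y (Sum.inl i) = x.coord i := by
      intro i
      have h1 : (X i - C (x.coord i) : MvPolynomial (Fin 4) ℂ) ∈ (toSpec x).asIdeal := by
        rw [mem_toSpec]; simp [ev]
      rw [← hQx, Ideal.mem_comap] at h1
      have h2 : (X (Sum.inl i) - C (x.coord i) : MvPolynomial (Fin 4 ⊕ Fin k) ℂ) ∈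
          Q.comap (Ideal.Quotient.mk _) := by
        rw [Ideal.mem_comap]
        convert h1 using 1
        change _ = coverMap E _
        simp [coverMap]
      rw [hy, mem_vanishingIdeal_singleton_iff] at h2
      simpa [sub_eq_zero] using h2
    refine ⟨fun i => y (Sum.inr i), fun e he => ?_⟩
    have h3 : e ∈ Q.comap (Ideal.Quotient.mk _) := by
      rw [Ideal.mem_comap, Ideal.Quotient.eq_zero_iff_mem.2 (Ideal.subset_span he)]
      exact Q.zero_mem
    rw [hy, mem_vanishingIdeal_singleton_iff] at h3
    have h4 : Sum.elim x.coord (fun i => y (Sum.inr i)) = y := by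
      ext (i | i) <;> simp [hyx]
    rw [h4]
    simpa [aeval_eq_eval] using h3

theorem isClosed_coverImage (h : (coverMap E).IsIntegral) : IsClosed (coverImage E) := by
  rw [coverImage_eq_zeros E h]
  exact isClosed_zeros _

/-- A point above `x` has height `4 + k` in the ambient space, and by Krull's height theorem the
equations lower it by at most `E.card`. Chains of primes below that point contract to strict chains
by incomparability. Their zero sets all pass through `x`, so they survive in `O`. -/
theorem le_topologicalKrullDim_coverImage (h : (coverMap E).IsIntegral) {O : Set AffFour}
    (hO : IsOpen O) {x : AffFour} (hx : x ∈ coverImage E) (hxO : x ∈ O) {n : ℕ}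
    (hn : n + E.card ≤ 4 + k) :
    n ≤ topologicalKrullDim (coverImage E ∩ O : Set AffFour) := by
  have himage := coverImage_eq_zeros E h
  obtain ⟨r, hr⟩ := hx
  set y := Sum.elim x.coord r with hy
  let M : Ideal (MvPolynomial (Fin 4 ⊕ Fin k) ℂ) := vanishingIdeal ℂ {y}
  have hEM : (E : Set (MvPolynomial (Fin 4 ⊕ Fin k) ℂ)) ⊆ M := fun e he => by
    rw [SetLike.mem_coe, mem_vanishingIdeal_singleton_iff, aeval_eq_eval]
    exact hr e he
  have hMp : (M.map (Ideal.Quotient.mk (Ideal.span (E : Set _)))).IsPrime :=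
    Ideal.isPrime_map_quotientMk_of_isPrime (Ideal.span_le.2 hEM)
  let M' : PrimeSpectrum (MvPolynomial (Fin 4 ⊕ Fin k) ℂ ⧸
    Ideal.span (E : Set (MvPolynomial (Fin 4 ⊕ Fin k) ℂ))) := ⟨_, hMp⟩
  have hht : (n : ℕ∞) ≤ Order.height M' := by
    have h1 := Ideal.height_le_height_add_encard_of_subset (p := M) _ hEM
    have h0 : M.height = _ := height_vanishingIdeal_singleton y
    rw [h0, Set.encard_coe_eq_coe_finsetCard] at h1
    have h2 : Order.height M' = M'.asIdeal.height := (PrimeSpectrum.height_eq_orderHeight M').symm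
    rw [h2]
    simp only [Fintype.card_sum, Fintype.card_fin] at h1
    have h3 : ((n + E.card : ℕ) : ℕ∞) ≤ M'.asIdeal.height + E.card :=
      le_trans (by exact_mod_cast hn) h1
    push_cast at h3
    exact (ENat.add_le_add_iff_right (ENat.natCast_ne_top _)).1 h3
  have hxM : ∀ Q : Set.Iic M', x ∈ zeros (Q.1.asIdeal.comap (coverMap E)) := by
    intro Q p hp
    have h1 : coverMap E p ∈ M'.asIdeal := Q.2 hp
    have h2 : rename Sum.inl p ∈ M := by
      have h3 := Ideal.comap_map_of_surjective (Ideal.Quotient.mk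
        (Ideal.span (E : Set (MvPolynomial (Fin 4 ⊕ Fin k) ℂ)))) Ideal.Quotient.mk_surjective M
      have h4 : rename Sum.inl p ∈ Ideal.comap (Ideal.Quotient.mk
        (Ideal.span (E : Set (MvPolynomial (Fin 4 ⊕ Fin k) ℂ)))) (M.map _) := h1
      rw [h3, ← RingHom.ker_eq_comap_bot, Ideal.mk_ker, sup_eq_left.2 (Ideal.span_le.2 hEM)] at h4
      exact h4
    rw [mem_vanishingIdeal_singleton_iff, aeval_eq_eval] at h2
    simpa [eval_rename, hy, ev] using h2
  have hsub : ∀ Q : Set.Iic M', zeros (Q.1.asIdeal.comap (coverMap E)) ⊆ coverImage E := by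
    intro Q z hz
    rw [himage]
    intro p hp
    refine hz p ?_
    rw [Ideal.mem_comap, RingHom.mem_ker.1 hp]
    exact Ideal.zero_mem _
  -- Larger primes have smaller zero sets, hence the order dual.
  let f : (Set.Iic M')ᵒᵈ → IrreducibleCloseds (coverImage E ∩ O : Set AffFour) := fun Q =>
    { carrier := (↑) ⁻¹' (zeros ((OrderDual.ofDual Q).1.asIdeal.comap (coverMap E)) ∩ O)
      isIrreducible' := by
        refine ⟨⟨⟨x, ⟨r, hr⟩, hxO⟩, hxM _, hxO⟩, ?_⟩
        refine IsPreirreducible.preimage_val ?_ (Set.inter_subset_inter_left _ (hsub _))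
        exact (isPreirreducible_zeros _).inter_isOpen hO
      isClosed' := by
        have : ((↑) ⁻¹' (zeros ((OrderDual.ofDual Q).1.asIdeal.comap (coverMap E)) ∩ O) :
          Set (coverImage E ∩ O : Set AffFour)) =
            (↑) ⁻¹' (zeros ((OrderDual.ofDual Q).1.asIdeal.comap (coverMap E))) := by
          ext z
          simp [z.2.2]
        rw [this]
        exact (isClosed_zeros _).preimage continuous_subtype_val }
  have hf : StrictMono f := by
    intro P Q hPQ
    have hlt : (OrderDual.ofDual Q).1.asIdeal < (OrderDual.ofDual P).1.asIdeal := hPQ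
    algebraize [coverMap E]
    have hlt' : (OrderDual.ofDual Q).1.asIdeal.comap (coverMap E) <
        (OrderDual.ofDual P).1.asIdeal.comap (coverMap E) :=
      Ideal.IsIntegral.comap_lt_comap (R := MvPolynomial (Fin 4) ℂ) hlt
    refine lt_of_le_of_ne (fun z hz => ⟨fun p hp => hz.1 p (hlt'.le hp), hz.2⟩) fun heq => ?_
    obtain ⟨g, hgP, hgQ⟩ := SetLike.exists_of_lt hlt'
    -- `h` vanishes off `O` but not at `x`, so it lies in no contracted prime of the chain. If the
    -- two traces on `O` agreed, `g * h` would vanish on the whole zero set of the smaller prime.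
    obtain ⟨h, hh, hhO⟩ := exists_basic hO hxO
    have hgh : g * h ∈ (OrderDual.ofDual Q).1.asIdeal.comap (coverMap E) := by
      refine mem_of_forall_zeros fun z hz => ?_
      by_contra hne
      rw [map_mul] at hne
      have hzO : z ∈ O := hhO (right_ne_zero_of_mul hne)
      have hzQ : (⟨z, hsub _ hz, hzO⟩ : (coverImage E ∩ O : Set AffFour)) ∈ f Q := ⟨hz, hzO⟩
      rw [← heq] at hzQ
      exact left_ne_zero_of_mul hne (hzQ.1 g hgP)
    rcases Ideal.IsPrime.mem_or_mem inferInstance hgh with h1 | h1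
    · exact hgQ h1
    · exact hh (hxM _ h h1)
  have h5 := Order.krullDim_le_of_strictMono f hf
  rw [Order.krullDim_orderDual, ← Order.height_eq_krullDim_Iic] at h5
  exact le_trans (by exact_mod_cast hht) h5

end Cover

end AffFour

/-! ### Charts of the Grassmannian -/

theorem pluecker_eq_smul {u v u' v' : Fin 4 → ℂ}
    (h : Submodule.span ℂ {u', v'} ≤ Submodule.span ℂ {u, v}) :
    ∃ c : ℂ, pluecker u' v' = c • pluecker u v := by
  obtain ⟨a, b, hu⟩ := Submodule.mem_span_pair.1 (h (Submodule.subset_span (by simp : u' ∈ _)))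
  obtain ⟨c, e, hv⟩ := Submodule.mem_span_pair.1 (h (Submodule.subset_span (by simp : v' ∈ _)))
  refine ⟨a * e - b * c, ?_⟩
  ext ij
  simp only [← hu, ← hv, pluecker, Pi.add_apply, Pi.smul_apply, smul_eq_mul]
  ring

theorem MvPolynomial.IsHomogeneous.eval_smul_eq {κ : Type*} {P : MvPolynomial κ ℂ} {k : ℕ}
    (hP : P.IsHomogeneous k) (c : ℂ) (x : κ → ℂ) : eval (c • x) P = c ^ k * eval x P := by
  rw [eval_eq, eval_eq, Finset.mul_sum]
  refine Finset.sum_congr rfl fun m hm => ?_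
  have hdeg : ∑ i ∈ m.support, m i = k := by
    have := hP (mem_support_iff.1 hm)
    rwa [Finsupp.weight_apply, Finsupp.sum, Finset.sum_congr rfl (fun i _ => by simp; rfl)] at this
  simp only [Pi.smul_apply, smul_eq_mul, mul_pow, Finset.prod_mul_distrib,
    Finset.prod_pow_eq_pow_sum, hdeg]
  ring

namespace ProjLine

/-- The nonvanishing locus of a form in the Plücker coordinates. -/
def basic (P : MvPolynomial (Fin 4 × Fin 4) ℂ) : Set ProjLine :=
  {L | ∃ u v : Fin 4 → ℂ, Submodule.span ℂ {u, v} = L.1 ∧ eval (pluecker u v) P ≠ 0}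

theorem isOpen_basic {P : MvPolynomial (Fin 4 × Fin 4) ℂ} {k : ℕ} (hP : P.IsHomogeneous k) :
    IsOpen (basic P) :=
  isOpen_generateFrom_of_mem ⟨k, P, hP, rfl⟩

/-- Another basis of the line only scales the Plücker coordinates, so by homogeneity the choice of
basis is immaterial. -/
theorem mem_basic_iff {P : MvPolynomial (Fin 4 × Fin 4) ℂ} {k : ℕ} (hP : P.IsHomogeneous k)
    {L : ProjLine} {u v : Fin 4 → ℂ} (h : Submodule.span ℂ {u, v} = L.1) :
    L ∈ basic P ↔ eval (pluecker u v) P ≠ 0 := by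
  refine ⟨?_, fun h' => ⟨u, v, h, h'⟩⟩
  rintro ⟨u', v', h', hne⟩ h0
  obtain ⟨c, hc⟩ := pluecker_eq_smul (h'.trans h.symm).le
  rw [hc, hP.eval_smul_eq, h0, mul_zero] at hne
  exact hne rfl

/-- The first spanning vector of the line with coordinates `x` in a chart. -/
def chartU {R : Type*} [CommRing R] (σ : Equiv.Perm (Fin 4)) (x : Fin 4 → R) (i : Fin 4) : R :=
  ![1, 0, x 0, x 1] (σ.symm i)

/-- The second spanning vector of the line with coordinates `x` in a chart. -/
def chartV {R : Type*} [CommRing R] (σ : Equiv.Perm (Fin 4)) (x : Fin 4 → R) (i : Fin 4) : R :=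
  ![0, 1, x 2, x 3] (σ.symm i)

@[simp] theorem chartU_apply {R : Type*} [CommRing R] (σ : Equiv.Perm (Fin 4)) (x : Fin 4 → R)
    (j : Fin 4) : chartU σ x (σ j) = ![1, 0, x 0, x 1] j := by simp [chartU]

@[simp] theorem chartV_apply {R : Type*} [CommRing R] (σ : Equiv.Perm (Fin 4)) (x : Fin 4 → R)
    (j : Fin 4) : chartV σ x (σ j) = ![0, 1, x 2, x 3] j := by simp [chartV]

theorem map_chartU {R S : Type*} [CommRing R] [CommRing S] (f : R →+* S) (σ : Equiv.Perm (Fin 4))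
    (x : Fin 4 → R) (i : Fin 4) : f (chartU σ x i) = chartU σ (fun j => f (x j)) i := by
  obtain ⟨j, rfl⟩ := σ.surjective i
  fin_cases j <;> simp

theorem map_chartV {R S : Type*} [CommRing R] [CommRing S] (f : R →+* S) (σ : Equiv.Perm (Fin 4))
    (x : Fin 4 → R) (i : Fin 4) : f (chartV σ x i) = chartV σ (fun j => f (x j)) i := by
  obtain ⟨j, rfl⟩ := σ.surjective i
  fin_cases j <;> simp

theorem linearIndependent_of_pluecker_ne_zero {u v : Fin 4 → ℂ} {ij : Fin 4 × Fin 4}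
    (h : pluecker u v ij ≠ 0) : LinearIndependent ℂ ![u, v] := by
  rw [LinearIndependent.pair_iff]
  intro s t hst
  have h1 := congrFun hst ij.1
  have h2 := congrFun hst ij.2
  simp only [Pi.add_apply, Pi.smul_apply, smul_eq_mul, Pi.zero_apply] at h1 h2
  unfold pluecker at h
  constructor
  · apply (mul_eq_zero.1 (?_ : s * (u ij.1 * v ij.2 - u ij.2 * v ij.1) = 0)).resolve_right h
    linear_combination v ij.2 * h1 - v ij.1 * h2
  · apply (mul_eq_zero.1 (?_ : t * (u ij.1 * v ij.2 - u ij.2 * v ij.1) = 0)).resolve_right h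
    linear_combination u ij.1 * h2 - u ij.2 * h1

theorem finrank_span_pair {u v : Fin 4 → ℂ} (h : LinearIndependent ℂ ![u, v]) :
    Module.finrank ℂ (Submodule.span ℂ {u, v}) = 2 := by
  have hr : Set.range ![u, v] = {u, v} := by
    ext w
    constructor
    · rintro ⟨i, rfl⟩
      fin_cases i <;> simp
    · rintro (rfl | rfl)
      · exact ⟨0, rfl⟩
      · exact ⟨1, rfl⟩
  rw [← hr, finrank_span_eq_card h, Fintype.card_fin]

theorem pluecker_chart (σ : Equiv.Perm (Fin 4)) (x : Fin 4 → ℂ) :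
    pluecker (chartU σ x) (chartV σ x) (σ 0, σ 1) = 1 := by
  simp [pluecker]

theorem linearIndependent_chart (σ : Equiv.Perm (Fin 4)) (x : Fin 4 → ℂ) :
    LinearIndependent ℂ ![chartU σ x, chartV σ x] :=
  linearIndependent_of_pluecker_ne_zero (ij := (σ 0, σ 1)) (by simp [pluecker_chart])

/-- The affine chart of the Grassmannian attached to a permutation of the coordinates. -/
def chart (σ : Equiv.Perm (Fin 4)) (x : AffFour) : ProjLine :=
  ⟨Submodule.span ℂ {chartU σ x.coord, chartV σ x.coord},
    finrank_span_pair (linearIndependent_chart σ x.coord)⟩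

theorem exists_chart_eq (σ : Equiv.Perm (Fin 4)) {L : ProjLine} {u v : Fin 4 → ℂ}
    (hL : Submodule.span ℂ {u, v} = L.1) (h : pluecker u v (σ 0, σ 1) ≠ 0) :
    ∃ x, chart σ x = L := by
  set c := pluecker u v (σ 0, σ 1) with hc
  have hc' : u (σ 0) * v (σ 1) - u (σ 1) * v (σ 0) = c := rfl
  -- Cramer's rule: `u'` and `v'` form the basis of the line whose entries at `σ 0`, `σ 1` make the
  -- identity matrix.
  let u' : Fin 4 → ℂ := (v (σ 1) / c) • u - (u (σ 1) / c) • v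
  let v' : Fin 4 → ℂ := (u (σ 0) / c) • v - (v (σ 0) / c) • u
  let x : AffFour := ⟨![u' (σ 2), u' (σ 3), v' (σ 2), v' (σ 3)]⟩
  have hu : chartU σ x.coord = u' := by
    ext i
    obtain ⟨j, rfl⟩ := σ.surjective i
    fin_cases j
    · simp only [Fin.zero_eta, chartU_apply, u', Pi.sub_apply, Pi.smul_apply, smul_eq_mul]
      simp only [Matrix.cons_val_zero]
      field_simp
      linear_combination -hc'
    · simp only [Fin.mk_one, chartU_apply, u', Pi.sub_apply, Pi.smul_apply, smul_eq_mul]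
      simp only [Matrix.cons_val_one, Matrix.cons_val_zero]
      ring
    · simp [x]
    · simp [x]
  have hv : chartV σ x.coord = v' := by
    ext i
    obtain ⟨j, rfl⟩ := σ.surjective i
    fin_cases j
    · simp only [Fin.zero_eta, chartV_apply, v', Pi.sub_apply, Pi.smul_apply, smul_eq_mul]
      simp only [Matrix.cons_val_zero]
      ring
    · simp only [Fin.mk_one, chartV_apply, v', Pi.sub_apply, Pi.smul_apply, smul_eq_mul]
      simp only [Matrix.cons_val_one, Matrix.cons_val_zero]
      field_simp
      linear_combination -hc'
    · simp [x]
    · simp [x]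
  have hmu : u ∈ Submodule.span ℂ {u, v} := Submodule.subset_span (by simp)
  have hmv : v ∈ Submodule.span ℂ {u, v} := Submodule.subset_span (by simp)
  refine ⟨x, Subtype.ext ?_⟩
  refine Submodule.eq_of_le_of_finrank_eq ?_ ((chart σ x).2.trans L.2.symm)
  change Submodule.span ℂ {chartU σ x.coord, chartV σ x.coord} ≤ L.1
  rw [hu, hv, Submodule.span_le, ← hL]
  rintro w (rfl | rfl)
  · exact sub_mem (Submodule.smul_mem _ _ hmu) (Submodule.smul_mem _ _ hmv)
  · exact sub_mem (Submodule.smul_mem _ _ hmv) (Submodule.smul_mem _ _ hmu)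

theorem exists_span_pair (L : ProjLine) :
    ∃ u v : Fin 4 → ℂ, Submodule.span ℂ {u, v} = L.1 ∧ LinearIndependent ℂ ![u, v] := by
  let b := Module.finBasisOfFinrankEq ℂ L.1 L.2
  have hb : LinearIndependent ℂ ![(b 0 : Fin 4 → ℂ), b 1] := by
    have := b.linearIndependent.map' L.1.subtype (Submodule.ker_subtype _)
    have hb' : ![(b 0 : Fin 4 → ℂ), b 1] = L.1.subtype ∘ b := by
      ext i : 1
      fin_cases i <;> simp
    rwa [hb']
  refine ⟨b 0, b 1, ?_, hb⟩
  refine Submodule.eq_of_le_of_finrank_eq ?_ ((finrank_span_pair hb).trans L.2.symm)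
  rw [Submodule.span_le]
  rintro w (rfl | rfl)
  · exact (b 0).2
  · exact (b 1).2

theorem exists_perm : ∀ i j : Fin 4, i ≠ j → ∃ σ : Equiv.Perm (Fin 4), σ 0 = i ∧ σ 1 = j := by
  decide

theorem exists_chart (L : ProjLine) : ∃ σ x, chart σ x = L := by
  obtain ⟨u, v, hL, hind⟩ := exists_span_pair L
  rw [LinearIndependent.pair_iff] at hind
  have : ∃ ij, pluecker u v ij ≠ 0 := by
    by_contra hcon
    push Not at hcon
    have hu : ∃ i, u i ≠ 0 := by
      by_contra hu
      push Not at hu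
      have := (hind 1 0 (by ext i; simp [hu i])).1
      exact one_ne_zero this
    obtain ⟨i, hi⟩ := hu
    have := (hind (v i) (-u i) (by
      ext j
      have := hcon (i, j)
      simp only [pluecker] at this
      simp only [Pi.add_apply, Pi.smul_apply, smul_eq_mul, Pi.zero_apply]
      linear_combination -this)).2
    exact hi (neg_eq_zero.1 this)
  obtain ⟨⟨i, j⟩, hij⟩ := this
  have hne : i ≠ j := by
    rintro rfl
    simp [pluecker] at hij
  obtain ⟨σ, rfl, rfl⟩ := exists_perm i j hne
  obtain ⟨x, hx⟩ := exists_chart_eq σ hL hij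
  exact ⟨σ, x, hx⟩

/-- The Plücker coordinates that restrict to the coordinate functions of a chart. -/
def chartCoord (σ : Equiv.Perm (Fin 4)) : Fin 4 → Fin 4 × Fin 4 :=
  ![(σ 2, σ 1), (σ 3, σ 1), (σ 0, σ 2), (σ 0, σ 3)]

theorem pluecker_chartCoord (σ : Equiv.Perm (Fin 4)) (x : Fin 4 → ℂ) (i : Fin 4) :
    pluecker (chartU σ x) (chartV σ x) (chartCoord σ i) = x i := by
  fin_cases i <;> simp [pluecker, chartCoord]

theorem chart_injective (σ : Equiv.Perm (Fin 4)) : Function.Injective (chart σ) := by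
  intro x y hxy
  obtain ⟨c, hc⟩ := pluecker_eq_smul (congrArg Subtype.val hxy).le
  have h1 := congrFun hc (σ 0, σ 1)
  simp only [Pi.smul_apply, pluecker_chart, smul_eq_mul, mul_one] at h1
  ext i
  have := congrFun hc (chartCoord σ i)
  simpa [pluecker_chartCoord, ← h1] using this

theorem continuous_chart (σ : Equiv.Perm (Fin 4)) : Continuous (chart σ) := by
  refine continuous_generateFrom_iff.2 ?_
  rintro _ ⟨k, P, hP, rfl⟩
  let x : Fin 4 → MvPolynomial (Fin 4) ℂ := X
  let Q : MvPolynomial (Fin 4) ℂ := aeval (fun ij : Fin 4 × Fin 4 =>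
    chartU σ x ij.1 * chartV σ x ij.2 - chartU σ x ij.2 * chartV σ x ij.1) P
  convert AffFour.isOpen_ne_zero Q using 1
  ext y
  change chart σ y ∈ basic P ↔ AffFour.ev y Q ≠ 0
  rw [mem_basic_iff hP (rfl : Submodule.span ℂ {chartU σ y.coord, chartV σ y.coord} = _)]
  have : AffFour.ev y Q = eval (pluecker (chartU σ y.coord) (chartV σ y.coord)) P := by
    simp only [Q, aeval_def, AffFour.ev]
    rw [hom_eval₂]
    congr 1
    · ext; simp
    · ext ij
      simp only [map_sub, map_mul, map_chartU, map_chartV, pluecker, x, eval_X]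
  rw [this]

/-- The homogenization, in the Plücker coordinates, of a polynomial on a chart. -/
noncomputable def homogenization (σ : Equiv.Perm (Fin 4)) (h : MvPolynomial (Fin 4) ℂ) :
    MvPolynomial (Fin 4 × Fin 4) ℂ :=
  -- The extra factor confines the nonvanishing locus to the chart, even for constant `h`.
  X (σ 0, σ 1) * ∑ m ∈ h.support, C (coeff m h) *
    (X (σ 0, σ 1) ^ (h.totalDegree - ∑ i, m i) * ∏ i, X (chartCoord σ i) ^ m i)

theorem isHomogeneous_homogenization (σ : Equiv.Perm (Fin 4)) (h : MvPolynomial (Fin 4) ℂ) :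
    (homogenization σ h).IsHomogeneous (1 + h.totalDegree) := by
  refine (isHomogeneous_X _ _).mul (IsHomogeneous.sum _ _ _ fun m hm => ?_)
  have hdeg : ∑ i, m i ≤ h.totalDegree := by
    have := le_totalDegree hm
    rwa [Finsupp.sum_fintype _ _ (fun _ => rfl)] at this
  have h1 := (isHomogeneous_C (Fin 4 × Fin 4) (coeff m h)).mul
    (((isHomogeneous_X ℂ (σ 0, σ 1)).pow (h.totalDegree - ∑ i, m i)).mul
      (IsHomogeneous.prod Finset.univ _ _ fun i _ => (isHomogeneous_X ℂ (chartCoord σ i)).pow (m i)))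
  convert h1 using 1
  simp only [one_mul, zero_add]
  omega

theorem eval_homogenization_chart (σ : Equiv.Perm (Fin 4)) (h : MvPolynomial (Fin 4) ℂ)
    (x : Fin 4 → ℂ) :
    eval (pluecker (chartU σ x) (chartV σ x)) (homogenization σ h) = eval x h := by
  rw [eval_eq' x h]
  simp [homogenization, pluecker_chart, pluecker_chartCoord]

theorem image_chart (σ : Equiv.Perm (Fin 4)) (h : MvPolynomial (Fin 4) ℂ) :
    chart σ '' {x | AffFour.ev x h ≠ 0} = basic (homogenization σ h) := by
  ext L
  constructor
  · rintro ⟨x, hx, rfl⟩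
    exact ⟨_, _, rfl, by rwa [eval_homogenization_chart]⟩
  · intro hL
    obtain ⟨u, v, huv, hne⟩ := id hL
    have h0 : pluecker u v (σ 0, σ 1) ≠ 0 := by
      intro h0
      apply hne
      simp [homogenization, h0]
    obtain ⟨x, rfl⟩ := exists_chart_eq σ huv h0
    refine ⟨x, ?_, rfl⟩
    rw [mem_basic_iff (isHomogeneous_homogenization σ h)
      (rfl : Submodule.span ℂ {chartU σ x.coord, chartV σ x.coord} = _),
      eval_homogenization_chart] at hL
    exact hL

theorem isOpenEmbedding_chart (σ : Equiv.Perm (Fin 4)) : IsOpenEmbedding (chart σ) := by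
  refine .of_continuous_injective_isOpenMap (continuous_chart σ) (chart_injective σ) ?_
  intro O hO
  rw [isOpen_iff_forall_mem_open]
  rintro _ ⟨x, hx, rfl⟩
  obtain ⟨h, hxh, hh⟩ := AffFour.exists_basic hO hx
  refine ⟨chart σ '' {y | AffFour.ev y h ≠ 0}, Set.image_mono hh, ?_, ⟨x, hxh, rfl⟩⟩
  rw [image_chart]
  exact isOpen_basic (isHomogeneous_homogenization σ h)

instance : NoetherianSpace ProjLine := by
  rw [← noetherian_univ_iff]
  have : (Set.univ : Set ProjLine) = ⋃ σ, Set.range (chart σ) := by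
    ext L
    simpa using exists_chart L
  rw [this]
  have := fun σ => NoetherianSpace.range (chart σ) (continuous_chart σ)
  exact NoetherianSpace.iUnion _

end ProjLine

/-- The dimension is the supremum of the coheights of irreducible closed sets. Such a set meets some
member of the cover, and everything in a chain above it meets that member too, so its coheight can
be computed there. -/
theorem topologicalKrullDim_le_of_isOpenEmbedding_cover {ι Y : Type*} {X : ι → Type*}
    [TopologicalSpace Y] [∀ i, TopologicalSpace (X i)] {f : ∀ i, X i → Y}
    (hf : ∀ i, IsOpenEmbedding (f i)) (hsurj : ∀ y, ∃ i x, f i x = y) {n : WithBot ℕ∞}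
    (h : ∀ i, topologicalKrullDim (X i) ≤ n) : topologicalKrullDim Y ≤ n := by
  rw [topologicalKrullDim, Order.krullDim_eq_iSup_coheight]
  refine iSup_le fun Z => ?_
  obtain ⟨z, hz⟩ := Z.isIrreducible.nonempty
  obtain ⟨i, x, rfl⟩ := hsurj z
  let e := IrreducibleCloseds.orderIsoOfIsOpenEmbedding (f i) (hf i)
  have he : IrreducibleCloseds.map (f i) (hf i).continuous (e.symm ⟨Z, ⟨x, hz⟩⟩) = Z :=
    congrArg Subtype.val (e.apply_symm_apply ⟨Z, ⟨x, hz⟩⟩)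
  rw [← he, (hf i).coheight_map]
  exact (Order.coheight_le_krullDim _).trans (h i)

namespace ProjLine

theorem topologicalKrullDim_le_of_chart {T : Set ProjLine} {n : WithBot ℕ∞}
    (h : ∀ σ, topologicalKrullDim (chart σ ⁻¹' T) ≤ n) : topologicalKrullDim T ≤ n := by
  refine topologicalKrullDim_le_of_isOpenEmbedding_cover
    (fun σ => (isOpenEmbedding_chart σ).restrictPreimage T) ?_ h
  rintro ⟨L, hL⟩
  obtain ⟨σ, x, rfl⟩ := exists_chart L
  exact ⟨σ, ⟨x, hL⟩, rfl⟩

theorem topologicalKrullDim_chart_preimage_le (σ : Equiv.Perm (Fin 4)) (T : Set ProjLine) :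
    topologicalKrullDim (chart σ ⁻¹' T) ≤ topologicalKrullDim T :=
  ((isOpenEmbedding_chart σ).restrictPreimage T).isInducing.topologicalKrullDim_le

end ProjLine

/-! ### Restriction of a form to a line -/

theorem eval_alongLine (F : MvPolynomial (Fin 4) ℂ) (a b : Fin 4 → ℂ) (t : ℂ) :
    (alongLine F a b).eval t = eval (a + t • b) F := by
  rw [alongLine, aeval_def, ← Polynomial.coe_evalRingHom, hom_eval₂, eval, ← coe_eval₂Hom]
  congr 1
  refine congrArg₂ _ ?_ ?_
  · ext; simp
  · ext i
    simp only [Polynomial.coe_evalRingHom, Polynomial.eval_add, Polynomial.eval_C,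
      Polynomial.eval_mul, Polynomial.eval_X, Pi.add_apply, Pi.smul_apply, smul_eq_mul]
    ring

section Homogeneous

variable {d : ℕ} {F : MvPolynomial (Fin 4) ℂ} (hF : F.IsHomogeneous d)
include hF

theorem natDegree_alongLine_le (a b : Fin 4 → ℂ) : (alongLine F a b).natDegree ≤ d := by
  rw [alongLine, aeval_def, eval₂_eq']
  refine Polynomial.natDegree_sum_le_of_forall_le _ _ fun m hm => ?_
  refine (Polynomial.natDegree_C_mul_le _ _).trans ((Polynomial.natDegree_prod_le _ _).trans ?_)
  have hdeg : ∑ i, m i = d := by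
    have := hF (mem_support_iff.1 hm)
    rw [Finsupp.weight_apply, Finsupp.sum_fintype _ _ (fun _ => by simp)] at this
    simpa using this
  rw [← hdeg]
  refine Finset.sum_le_sum fun i _ => ?_
  refine Polynomial.natDegree_pow_le.trans ?_
  have h1 : (Polynomial.C (a i) + Polynomial.C (b i) * Polynomial.X).natDegree ≤ 1 := by
    compute_degree
  exact (Nat.mul_le_mul_left _ h1).trans (mul_one _).le

theorem eval_smul_add_smul {α : ℂ} (hα : α ≠ 0) (β : ℂ) (a b : Fin 4 → ℂ) :
    eval (α • a + β • b) F = α ^ d * (alongLine F a b).eval (β / α) := by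
  rw [eval_alongLine, ← hF.eval_smul_eq]
  congr 1
  rw [smul_add, smul_smul, mul_div_cancel₀ _ hα]

theorem reflect_alongLine (a b : Fin 4 → ℂ) :
    (alongLine F a b).reflect d = alongLine F b a := by
  -- The factor `X` disposes of `t = 0`, where the substitution of `t⁻¹` below makes no sense.
  apply mul_left_cancel₀ (Polynomial.X_ne_zero (R := ℂ))
  refine Polynomial.funext fun t => ?_
  simp only [Polynomial.eval_mul, Polynomial.eval_X]
  by_cases ht : t = 0
  · simp [ht]
  congr 1
  have hinv : t⁻¹ ≠ 0 := inv_ne_zero ht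
  let _ : Invertible t⁻¹ := invertibleOfNonzero hinv
  have h1 := Polynomial.eval₂_reflect_mul_pow (RingHom.id ℂ) t⁻¹ d _ (natDegree_alongLine_le hF a b)
  rw [invOf_eq_inv, inv_inv, Polynomial.eval₂_id, Polynomial.eval₂_id] at h1
  have h2 := eval_smul_add_smul hF ht 1 a b
  rw [one_div, ← h1, one_smul, add_comm] at h2
  rw [eval_alongLine, h2, mul_comm, mul_assoc, ← mul_pow, inv_mul_cancel₀ ht, one_pow, mul_one]

/-- The vector `b` is the point at infinity of the parametrization: this coefficient is nonzero
exactly when all the intersection points are at finite distance. -/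
theorem coeff_alongLine (a b : Fin 4 → ℂ) : (alongLine F a b).coeff d = eval b F := by
  have h := congrArg (fun p => Polynomial.coeff p 0) (reflect_alongLine hF a b)
  simp only [Polynomial.coeff_reflect, Polynomial.revAt_le (Nat.zero_le d), Nat.sub_zero] at h
  rw [h, Polynomial.coeff_zero_eq_eval_zero, eval_alongLine, zero_smul, add_zero]

theorem natDegree_alongLine {a b : Fin 4 → ℂ} (hb : eval b F ≠ 0) :
    (alongLine F a b).natDegree = d :=
  (natDegree_alongLine_le hF a b).antisymm
    (Polynomial.le_natDegree_of_ne_zero (by rwa [coeff_alongLine hF]))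

theorem eval_eq_zero_of_alongLine_eq_zero {a b : Fin 4 → ℂ} (h : alongLine F a b = 0)
    {w : Fin 4 → ℂ} (hw : w ∈ Submodule.span ℂ {a, b}) : eval w F = 0 := by
  obtain ⟨α, β, rfl⟩ := Submodule.mem_span_pair.1 hw
  by_cases hα : α = 0
  · have := coeff_alongLine hF a b
    rw [h, Polynomial.coeff_zero] at this
    rw [hα, zero_smul, zero_add, hF.eval_smul_eq, ← this, mul_zero]
  · rw [eval_smul_add_smul hF hα, h, Polynomial.eval_zero, mul_zero]

/-- The intersection multiplicity does not depend on the parametrization. With `A = s + α t` and `B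
= γ t` the moving point is `A u + (r A + B) v`, where the form takes the value `A ^ d * f (r + B /
A)`. Writing `f = (X - r) ^ m * g` extracts exactly `t ^ m`. -/
theorem rootMultiplicity_alongLine {u v : Fin 4 → ℂ} {r s α γ : ℂ} (hs : s ≠ 0) (hγ : γ ≠ 0)
    (h0 : alongLine F u v ≠ 0) :
    (alongLine F (s • (u + r • v)) (α • (u + r • v) + γ • v)).rootMultiplicity 0 =
      (alongLine F u v).rootMultiplicity r := by
  set f := alongLine F u v with hf
  set m := f.rootMultiplicity r
  obtain ⟨g, hg, hgr⟩ := Polynomial.exists_eq_pow_rootMultiplicity_mul_and_not_dvd f h0 r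
  have hgr : g.eval r ≠ 0 := fun h => hgr (Polynomial.dvd_iff_isRoot.2 h)
  have hg0 : g ≠ 0 := by rintro rfl; simp at hgr
  have hdeg : m + g.natDegree ≤ d := by
    have h1 := natDegree_alongLine_le hF u v
    rw [← hf, hg, Polynomial.natDegree_mul (pow_ne_zero _ (Polynomial.X_sub_C_ne_zero r)) hg0,
      Polynomial.natDegree_pow, Polynomial.natDegree_X_sub_C, mul_one] at h1
    exact h1
  let A : Polynomial ℂ := Polynomial.C s + Polynomial.C α * Polynomial.X
  let B : Polynomial ℂ := Polynomial.C γ * Polynomial.X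
  -- `H` is `A ^ (d - m) * g (r + B / A)` with denominators cleared, which is possible since `g` has
  -- degree at most `d - m`.
  let H : Polynomial ℂ := ∑ j ∈ Finset.range (d - m + 1),
    Polynomial.C (g.coeff j) * A ^ (d - m - j) * (Polynomial.C r * A + B) ^ j
  have hA0 : A ≠ 0 := by
    intro h
    have := congrArg (Polynomial.eval 0) h
    simp [A, hs] at this
  have hH : ∀ t, A.eval t ≠ 0 → H.eval t =
      A.eval t ^ (d - m) * g.eval (r + B.eval t / A.eval t) := by
    intro t ht
    rw [Polynomial.eval_eq_sum_range' (by omega : g.natDegree < d - m + 1), Finset.mul_sum]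
    simp only [H, Polynomial.eval_finsetSum]
    refine Finset.sum_congr rfl fun j hj => ?_
    have hj' : j ≤ d - m := Nat.lt_succ_iff.1 (Finset.mem_range.1 hj)
    simp only [Polynomial.eval_mul, Polynomial.eval_C, Polynomial.eval_pow, Polynomial.eval_add]
    have h1 : r * A.eval t + B.eval t = A.eval t * (r + B.eval t / A.eval t) := by
      field_simp
    rw [h1, mul_pow]
    calc _ = g.coeff j * (A.eval t ^ (d - m - j) * A.eval t ^ j) *
          (r + B.eval t / A.eval t) ^ j := by ring
      _ = _ := by rw [← pow_add, Nat.sub_add_cancel hj']; ring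
  have hkey : alongLine F (s • (u + r • v)) (α • (u + r • v) + γ • v) =
      (Polynomial.X - Polynomial.C 0) ^ m * (Polynomial.C (γ ^ m) * H) := by
    apply mul_left_cancel₀ hA0
    refine Polynomial.funext fun t => ?_
    rw [Polynomial.eval_mul, Polynomial.eval_mul]
    by_cases ht : A.eval t = 0
    · simp [ht]
    congr 1
    have h1 : s • (u + r • v) + t • (α • (u + r • v) + γ • v) =
        A.eval t • u + (r * A.eval t + B.eval t) • v := by
      ext i
      simp [A, B]
      ring
    have h2 : (r * A.eval t + B.eval t) / A.eval t = r + B.eval t / A.eval t := by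
      field_simp
    rw [eval_alongLine, h1, eval_smul_add_smul hF ht, ← hf, h2]
    conv_lhs => rw [hg]
    simp only [Polynomial.eval_mul, Polynomial.eval_pow, Polynomial.eval_sub, Polynomial.eval_X,
      Polynomial.eval_C, sub_zero, hH t ht, add_sub_cancel_left]
    have h3 : A.eval t ^ d = A.eval t ^ m * A.eval t ^ (d - m) := by
      rw [← pow_add]; congr 1; omega
    have h4 : t ^ m * γ ^ m = B.eval t ^ m := by
      simp only [B, Polynomial.eval_mul, Polynomial.eval_C, Polynomial.eval_X]
      rw [mul_comm γ t, mul_pow]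
    rw [h3, ← mul_assoc (t ^ m), h4, div_pow]
    have := pow_ne_zero m ht
    change _ * (B.eval t ^ m / A.eval t ^ m * _) = _
    generalize g.eval (r + B.eval t / A.eval t) = y
    field_simp
  have hHne : (Polynomial.C (γ ^ m) * H).eval 0 ≠ 0 := by
    have hA : A.eval 0 = s := by simp [A]
    have hB : B.eval 0 = 0 := by simp [B]
    rw [Polynomial.eval_mul, Polynomial.eval_C, hH 0 (by rwa [hA]), hA, hB, zero_div, add_zero]
    exact mul_ne_zero (pow_ne_zero _ hγ) (mul_ne_zero (pow_ne_zero _ hs) hgr)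
  have hne : (Polynomial.X - Polynomial.C 0) ^ m * (Polynomial.C (γ ^ m) * H) ≠ 0 := by
    refine mul_ne_zero (pow_ne_zero _ (Polynomial.X_sub_C_ne_zero 0)) ?_
    intro h
    rw [h, Polynomial.eval_zero] at hHne
    exact hHne rfl
  rw [hkey, Polynomial.rootMultiplicity_mul hne, Polynomial.rootMultiplicity_X_sub_C_pow,
    Polynomial.rootMultiplicity_eq_zero hHne, add_zero]

end Homogeneous

/-! ### The partition of a line -/

/-- The multiset of the multiplicities of the roots of a polynomial. -/
noncomputable def rootPartition (f : Polynomial ℂ) : Multiset ℕ :=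
  f.roots.toFinset.val.map fun r => f.rootMultiplicity r

theorem card_rootPartition (f : Polynomial ℂ) :
    (rootPartition f).card = f.roots.toFinset.card :=
  Multiset.card_map _ _

namespace Surface

variable {d : ℕ} (X : Surface d)

theorem form_isHomogeneous : X.form.IsHomogeneous d :=
  (mem_homogeneousSubmodule d _).1 (Projectivization.rep X).2

variable {L : ProjLine} {u v : Fin 4 → ℂ} (hL : Submodule.span ℂ {u, v} = L.1)
  (hind : LinearIndependent ℂ ![u, v])

include hind in
theorem add_smul_ne_zero (r : ℂ) : u + r • v ≠ 0 := by
  intro h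
  rw [LinearIndependent.pair_iff] at hind
  exact one_ne_zero (hind 1 r (by rw [one_smul, h])).1

/-- The point `u + r v` of the line spanned by `u` and `v`. -/
noncomputable def linePoint (hind : LinearIndependent ℂ ![u, v]) (r : ℂ) : ℙ ℂ (Fin 4 → ℂ) :=
  Projectivization.mk ℂ (u + r • v) (add_smul_ne_zero hind r)

theorem exists_linePoint_rep (r : ℂ) :
    ∃ s : ℂ, s ≠ 0 ∧ (linePoint hind r).rep = s • (u + r • v) := by
  obtain ⟨s, hs⟩ := Projectivization.exists_smul_eq_mk_rep ℂ (u + r • v) (add_smul_ne_zero hind r)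
  exact ⟨s, s.ne_zero, hs.symm⟩

theorem linePoint_injective : Function.Injective (linePoint hind) := by
  intro r r' h
  obtain ⟨s, hs⟩ := (Projectivization.mk_eq_mk_iff' ℂ _ _ _ _).1 h
  rw [LinearIndependent.pair_iff] at hind
  have := hind (s - 1) (s * r' - r) (by
    rw [← sub_eq_zero] at hs
    rw [← hs]
    ext i
    simp
    ring)
  have h1 : s = 1 := sub_eq_zero.1 this.1
  have h2 := sub_eq_zero.1 this.2
  rw [h1, one_mul] at h2
  exact h2.symm

include hL in
theorem linePoint_submodule_le (r : ℂ) : (linePoint hind r).submodule ≤ L.1 := by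
  rw [linePoint, Projectivization.submodule_mk, Submodule.span_singleton_le_iff_mem, ← hL]
  exact Submodule.mem_span_pair.2 ⟨1, r, by simp⟩

theorem eval_linePoint_rep (r : ℂ) :
    eval (linePoint hind r).rep X.form = 0 ↔ (alongLine X.form u v).IsRoot r := by
  obtain ⟨s, hs, hrep⟩ := exists_linePoint_rep hind r
  rw [hrep, X.form_isHomogeneous.eval_smul_eq, Polynomial.IsRoot, eval_alongLine]
  simp [hs]

include hL in
theorem linePoint_mem_inter {r : ℂ} (h : (alongLine X.form u v).IsRoot r) :
    linePoint hind r ∈ X.inter L :=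
  ⟨linePoint_submodule_le hL hind r, (X.eval_linePoint_rep hind r).2 h⟩

include hL in
theorem interMult_linePoint (h0 : alongLine X.form u v ≠ 0) (r : ℂ) :
    X.interMult L (linePoint hind r) = (alongLine X.form u v).rootMultiplicity r := by
  obtain ⟨s, hs, hrep⟩ := exists_linePoint_rep hind r
  have hind' := LinearIndependent.pair_iff.1 hind
  have hset : {m | ∃ b ∈ L.1, b ∉ (linePoint hind r).submodule ∧
      m = (alongLine X.form (linePoint hind r).rep b).rootMultiplicity 0} =
      {(alongLine X.form u v).rootMultiplicity r} := by
    ext m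
    constructor
    · rintro ⟨b, hb, hbq, rfl⟩
      rw [← hL] at hb
      obtain ⟨α, β, rfl⟩ := Submodule.mem_span_pair.1 hb
      have hb' : α • u + β • v = α • (u + r • v) + (β - α * r) • v := by
        ext i
        simp
        ring
      have hγ : β - α * r ≠ 0 := by
        intro h
        rw [hb', h, zero_smul, add_zero, linePoint, Projectivization.submodule_mk] at hbq
        exact hbq (Submodule.smul_mem _ _ (Submodule.mem_span_singleton_self _))
      rw [hb', hrep, rootMultiplicity_alongLine X.form_isHomogeneous hs hγ h0]
      rfl
    · rintro rfl
      refine ⟨v, hL ▸ Submodule.subset_span (by simp), ?_, ?_⟩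
      · rw [linePoint, Projectivization.submodule_mk, Submodule.mem_span_singleton]
        rintro ⟨c, hc⟩
        have := hind' c (c * r - 1) (by
          rw [← sub_eq_zero] at hc
          rw [← hc]
          ext i
          simp
          ring)
        rw [this.1, zero_mul, zero_sub, neg_eq_zero] at this
        exact one_ne_zero this.2
      · have := rootMultiplicity_alongLine X.form_isHomogeneous (r := r) (α := 0) hs one_ne_zero h0
        rw [hrep, ← this, zero_smul, zero_add, one_smul]
  rw [interMult, hset, csInf_singleton]

include hL in
theorem bijOn_linePoint (hv : eval v X.form ≠ 0) :
    Set.BijOn (linePoint hind) ((alongLine X.form u v).roots.toFinset : Set ℂ) (X.inter L) := by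
  have h0 : alongLine X.form u v ≠ 0 := by
    intro h
    have := coeff_alongLine X.form_isHomogeneous u v
    rw [h, Polynomial.coeff_zero] at this
    exact hv this.symm
  refine ⟨fun r hr => X.linePoint_mem_inter hL hind ?_, (linePoint_injective hind).injOn, ?_⟩
  · simpa [h0] using hr
  · rintro q ⟨hqL, hq⟩
    have hmem : q.rep ∈ Submodule.span ℂ {u, v} := by
      rw [hL]
      apply hqL
      rw [Projectivization.submodule_eq]
      exact Submodule.mem_span_singleton_self _
    obtain ⟨α, β, hαβ⟩ := Submodule.mem_span_pair.1 hmem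
    have hα : α ≠ 0 := by
      rintro rfl
      rw [zero_smul, zero_add] at hαβ
      have hβ : β ≠ 0 := by
        rintro rfl
        exact q.rep_nonzero (by rw [← hαβ, zero_smul])
      rw [← hαβ, X.form_isHomogeneous.eval_smul_eq] at hq
      exact mul_ne_zero (pow_ne_zero _ hβ) hv hq
    have hqr : linePoint hind (β / α) = q := by
      rw [← q.mk_rep]
      refine (Projectivization.mk_eq_mk_iff' ℂ _ _ _ _).2 ⟨α⁻¹, ?_⟩
      rw [← hαβ, smul_add, smul_smul, smul_smul, inv_mul_cancel₀ hα, one_smul, div_eq_inv_mul]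
    refine ⟨β / α, ?_, hqr⟩
    have : (alongLine X.form u v).IsRoot (β / α) := by
      rw [← X.eval_linePoint_rep hind, hqr, hq]
    simpa [h0] using this

include hL hind in
theorem interPartition_eq (hv : eval v X.form ≠ 0) :
    X.interPartition L = rootPartition (alongLine X.form u v) := by
  have h0 : alongLine X.form u v ≠ 0 := by
    intro h
    have := coeff_alongLine X.form_isHomogeneous u v
    rw [h, Polynomial.coeff_zero] at this
    exact hv this.symm
  rw [interPartition, ← finsum_mem_eq_of_bijOn (linePoint hind) (X.bijOn_linePoint hL hind hv)
    (f := fun r => ({(alongLine X.form u v).rootMultiplicity r} : Multiset ℕ))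
    (fun r _ => by rw [X.interMult_linePoint hL hind h0]), finsum_mem_coe_finset, rootPartition,
    Finset.sum]
  conv_rhs => rw [← Multiset.sum_map_singleton (Multiset.map _ _), Multiset.map_map]
  rfl

end Surface

/-! ### Polynomials with prescribed root multiplicities -/

section ProdRoots

variable {R : Type*} [CommRing R] {k : ℕ}

/-- The monic polynomial with roots `r i` of multiplicities `μ i`. -/
noncomputable def prodRoots (μ : Fin k → ℕ) (r : Fin k → R) : Polynomial R :=
  ∏ i, (Polynomial.X - Polynomial.C (r i)) ^ μ i

theorem prodRoots_monic (μ : Fin k → ℕ) (r : Fin k → R) : (prodRoots μ r).Monic :=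
  Polynomial.monic_prod_of_monic _ _ fun _ _ => (Polynomial.monic_X_sub_C _).pow _

theorem natDegree_prodRoots [Nontrivial R] (μ : Fin k → ℕ) (r : Fin k → R) :
    (prodRoots μ r).natDegree = ∑ i, μ i := by
  rw [prodRoots, Polynomial.natDegree_prod_of_monic _ _
    fun _ _ => (Polynomial.monic_X_sub_C _).pow _]
  simp [(Polynomial.monic_X_sub_C _).natDegree_pow]

theorem map_prodRoots {S : Type*} [CommRing S] (f : R →+* S) (μ : Fin k → ℕ) (r : Fin k → R) :
    (prodRoots μ r).map f = prodRoots μ fun i => f (r i) := by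
  simp [prodRoots, Polynomial.map_prod]

theorem eval_prodRoots {μ : Fin k → ℕ} (r : Fin k → R) {i : Fin k} (hi : 0 < μ i) :
    (prodRoots μ r).eval (r i) = 0 := by
  rw [prodRoots, Polynomial.eval_prod]
  exact Finset.prod_eq_zero (Finset.mem_univ i) (by simp [hi.ne'])

theorem prodRoots_comp (μ : Fin k → ℕ) (r : Fin k → ℂ) {a : ℂ} (ha : a ≠ 0) :
    (prodRoots μ r).comp (Polynomial.C a * Polynomial.X) =
      Polynomial.C (a ^ ∑ i, μ i) * prodRoots μ fun i => r i / a := by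
  rw [prodRoots, Polynomial.prod_comp, prodRoots, Polynomial.C_pow, ← Finset.prod_pow_eq_pow_sum,
    ← Finset.prod_mul_distrib]
  refine Finset.prod_congr rfl fun i _ => ?_
  rw [Polynomial.pow_comp, ← mul_pow, Polynomial.sub_comp, Polynomial.X_comp, Polynomial.C_comp,
    mul_sub, ← Polynomial.C_mul, mul_div_cancel₀ _ ha]

/-- With `a = f.coeff d`, the polynomial `a ^ (d - 1) * f (t / a)` is monic, its lower coefficients
are `a ^ (d - 1 - j) * f.coeff j`, and its roots are those of `f` times `a`. This makes the
equations for the roots monic without inverting `a`. -/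
theorem eq_C_mul_prodRoots_iff {d : ℕ} {μ : Fin k → ℕ} (hμ : ∑ i, μ i = d) (r : Fin k → ℂ)
    {f : Polynomial ℂ} (hf : f.natDegree ≤ d) (ha : f.coeff d ≠ 0) :
    (∀ j < d, (prodRoots μ r).coeff j = f.coeff d ^ (d - 1 - j) * f.coeff j) ↔
      f = Polynomial.C (f.coeff d) * prodRoots μ fun i => r i / f.coeff d := by
  set a := f.coeff d with ha'
  have hcoeff : ∀ j, (prodRoots μ r).coeff j * a ^ j =
      a ^ d * (prodRoots μ fun i => r i / a).coeff j := by
    intro j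
    have := congrArg (fun p => Polynomial.coeff p j) (prodRoots_comp μ r ha)
    rwa [Polynomial.comp_C_mul_X_coeff, Polynomial.coeff_C_mul, hμ] at this
  have hpow : ∀ j < d, a ^ d = a * a ^ (d - 1 - j) * a ^ j := by
    intro j hj
    rw [← pow_succ', ← pow_add]
    congr 1
    omega
  constructor
  · intro h
    ext j
    rw [Polynomial.coeff_C_mul]
    rcases lt_trichotomy j d with hj | rfl | hj
    · have h1 := hcoeff j
      rw [h j hj, hpow j hj] at h1
      apply mul_left_cancel₀ (mul_ne_zero (pow_ne_zero (d - 1 - j) ha) (pow_ne_zero j ha))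
      linear_combination h1
    · have h1 := (prodRoots_monic μ fun i => r i / a).coeff_natDegree
      rw [natDegree_prodRoots, hμ] at h1
      rw [h1, mul_one]
    · rw [Polynomial.coeff_eq_zero_of_natDegree_lt (hf.trans_lt hj),
        Polynomial.coeff_eq_zero_of_natDegree_lt (by rwa [natDegree_prodRoots, hμ]), mul_zero]
  · intro h j hj
    have h1 := hcoeff j
    have h2 : f.coeff j = a * (prodRoots μ fun i => r i / a).coeff j := by
      conv_lhs => rw [h]
      rw [Polynomial.coeff_C_mul]
    rw [hpow j hj] at h1
    rw [h2]
    apply mul_right_cancel₀ (pow_ne_zero j ha)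
    linear_combination h1

end ProdRoots

section RootPartition

variable {k : ℕ}

theorem roots_C_mul_prodRoots {a : ℂ} (ha : a ≠ 0) (μ : Fin k → ℕ) (r : Fin k → ℂ) :
    (Polynomial.C a * prodRoots μ r).roots = ∑ i, μ i • {r i} := by
  rw [Polynomial.roots_C_mul _ ha, prodRoots, Polynomial.roots_prod]
  · simp [Polynomial.roots_pow, Multiset.bind, Multiset.join, Finset.sum]
  · exact Finset.prod_ne_zero_iff.2 fun i _ => pow_ne_zero _ (Polynomial.X_sub_C_ne_zero _)

theorem toFinset_roots_C_mul_prodRoots {a : ℂ} (ha : a ≠ 0) {μ : Fin k → ℕ} (hμ : ∀ i, 0 < μ i)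
    (r : Fin k → ℂ) :
    (Polynomial.C a * prodRoots μ r).roots.toFinset = Finset.univ.image r := by
  ext z
  rw [Multiset.mem_toFinset, roots_C_mul_prodRoots ha, Multiset.mem_sum]
  simp only [Finset.mem_univ, true_and, Finset.mem_image]
  refine exists_congr fun i => ?_
  rw [Multiset.mem_nsmul, Multiset.mem_singleton]
  exact ⟨fun h => h.2.symm, fun h => ⟨(hμ i).ne', h.symm⟩⟩

theorem rootPartition_C_mul_prodRoots {a : ℂ} (ha : a ≠ 0) {μ : Fin k → ℕ} (hμ : ∀ i, 0 < μ i)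
    {r : Fin k → ℂ} (hr : Function.Injective r) :
    rootPartition (Polynomial.C a * prodRoots μ r) = Finset.univ.val.map μ := by
  rw [rootPartition, toFinset_roots_C_mul_prodRoots ha hμ, Finset.image_val_of_injOn hr.injOn,
    Multiset.map_map]
  refine Multiset.map_congr rfl fun i _ => ?_
  rw [Function.comp_apply, ← Polynomial.count_roots, roots_C_mul_prodRoots ha,
    Multiset.count_sum']
  rw [Finset.sum_eq_single i]
  · simp
  · intro j _ hj
    rw [Multiset.count_nsmul, Multiset.count_singleton, if_neg (fun h => hj (hr h).symm), mul_zero]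
  · simp

theorem exists_eq_C_mul_prodRoots (f : Polynomial ℂ) {k : ℕ}
    (hk : f.roots.toFinset.card = k) :
    ∃ (μ : Fin k → ℕ) (r : Fin k → ℂ), Function.Injective r ∧ (∀ i, 0 < μ i) ∧
      ∑ i, μ i = f.natDegree ∧ f = Polynomial.C f.leadingCoeff * prodRoots μ r ∧
      rootPartition f = Finset.univ.val.map μ := by
  by_cases hf : f = 0
  · subst hf
    simp only [Polynomial.roots_zero, Multiset.toFinset_zero, Finset.card_empty] at hk
    subst hk
    exact ⟨Fin.elim0, Fin.elim0, fun i => i.elim0, fun i => i.elim0, by simp, by simp,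
      by simp [rootPartition]⟩
  let e := (Finset.equivFinOfCardEq hk).symm
  let r : Fin k → ℂ := fun i => e i
  let μ : Fin k → ℕ := fun i => f.rootMultiplicity (r i)
  have hr : Function.Injective r := Subtype.val_injective.comp e.injective
  have hμ : ∀ i, 0 < μ i := fun i =>
    (Polynomial.rootMultiplicity_pos hf).2 (by
      have := (e i).2
      rw [Multiset.mem_toFinset, Polynomial.mem_roots hf] at this
      exact this)
  have hprod : f = Polynomial.C f.leadingCoeff * prodRoots μ r := by
    have h1 := Polynomial.C_leadingCoeff_mul_prod_multiset_X_sub_C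
      (IsAlgClosed.card_roots_eq_natDegree (p := f))
    have h2 : (f.roots.map fun a => Polynomial.X - Polynomial.C a).prod = prodRoots μ r := by
      rw [Finset.prod_multiset_map_count, prodRoots, ← Finset.prod_coe_sort,
        ← Equiv.prod_comp e]
      refine Finset.prod_congr rfl fun i _ => ?_
      rw [Polynomial.count_roots]
    rw [← h2, h1]
  refine ⟨μ, r, hr, hμ, ?_, hprod, ?_⟩
  · have hl : f.leadingCoeff ≠ 0 := Polynomial.leadingCoeff_ne_zero.2 hf
    conv_rhs => rw [hprod]
    rw [Polynomial.natDegree_C_mul hl, natDegree_prodRoots]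
  · conv_lhs => rw [hprod]
    exact rootPartition_C_mul_prodRoots (Polynomial.leadingCoeff_ne_zero.2 hf) hμ hr

theorem sum_rootPartition (f : Polynomial ℂ) : (rootPartition f).sum = f.natDegree := by
  obtain ⟨μ, r, -, -, h1, -, h2⟩ := exists_eq_C_mul_prodRoots f rfl
  rw [h2, ← h1]
  rfl

theorem pos_of_mem_rootPartition {f : Polynomial ℂ} {n : ℕ} (hn : n ∈ rootPartition f) : 0 < n := by
  obtain ⟨μ, r, -, h1, -, -, h2⟩ := exists_eq_C_mul_prodRoots f rfl
  rw [h2] at hn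
  obtain ⟨i, -, rfl⟩ := Multiset.mem_map.1 hn
  exact h1 i

end RootPartition

/-! ### Partitions with few parts different from one -/

/-- Take for `s` the parts that are at least `2`. Parts equal to `1` do not contribute to the
defect, so it can be read off from `s`. -/
theorem exists_eq_withOnes {d : ℕ} {p : Multiset ℕ} (hp : ∀ n ∈ p, 0 < n) (hsum : p.sum = d) :
    ∃ s : Multiset ℕ, (∀ n ∈ s, 2 ≤ n) ∧ p = withOnes d s ∧ s.sum + p.card = s.card + d := by
  set s := p.filter (2 ≤ ·) with hs
  set t := p.filter (¬ 2 ≤ ·) with ht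
  have hst : s + t = p := Multiset.filter_add_not _ _
  have ht1 : t = Multiset.replicate t.card 1 := by
    refine Multiset.eq_replicate_card.2 fun n hn => ?_
    have := Multiset.mem_filter.1 hn
    have := hp n this.1
    omega
  have htsum : t.sum = t.card := by
    conv_lhs => rw [ht1]
    simp
  have h1 : s.sum + t.sum = d := by rw [← Multiset.sum_add, hst, hsum]
  have h2 : s.card + t.card = p.card := by rw [← Multiset.card_add, hst]
  refine ⟨s, fun n hn => (Multiset.mem_filter.1 hn).2, ?_, by omega⟩
  rw [withOnes]
  conv_lhs => rw [← hst, ht1]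
  congr 2
  omega

theorem card_withOnes {d : ℕ} {s : Multiset ℕ} (h : s.sum ≤ d) :
    (withOnes d s).card + s.sum = s.card + d := by
  simp only [withOnes, Multiset.card_add, Multiset.card_replicate]
  omega

theorem sum_withOnes {d : ℕ} {s : Multiset ℕ} (h : (withOnes d s).sum = d) : s.sum ≤ d := by
  simp only [withOnes, Multiset.sum_add, Multiset.sum_replicate] at h
  omega

theorem card_le_sum_of_two_le {s : Multiset ℕ} (hs : ∀ n ∈ s, 2 ≤ n) :
    2 * s.card ≤ s.sum := by
  have := Multiset.card_nsmul_le_sum hs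
  rwa [smul_eq_mul, mul_comm] at this

/-- Each part contributes at least `1` to a defect of at most `4`, so there are at most four parts,
and four parts must all equal `2`. The rest is a finite check. -/
theorem mem_list_of_sum_le {s : Multiset ℕ} (hs : ∀ n ∈ s, 2 ≤ n) (hsum : s.sum ≤ s.card + 4) :
    s ∈ ({0, {2}, {2, 2}, {3}, {2, 2, 2}, {3, 2}, {4},
          {2, 2, 2, 2}, {3, 2, 2}, {3, 3}, {4, 2}, {5}} : Set (Multiset ℕ)) := by
  have hcard : s.card ≤ 4 := by
    have := card_le_sum_of_two_le hs
    omega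
  simp only [Set.mem_insert_iff, Set.mem_singleton_iff]
  obtain h | h | h | h | h : s.card = 0 ∨ s.card = 1 ∨ s.card = 2 ∨ s.card = 3 ∨ s.card = 4 := by
    omega
  · left
    exact Multiset.card_eq_zero.1 h
  · obtain ⟨a, rfl⟩ := Multiset.card_eq_one.1 h
    have ha := hs a (by simp)
    simp only [Multiset.sum_singleton, Multiset.card_singleton] at hsum
    interval_cases a <;> decide
  · obtain ⟨a, b, rfl⟩ := Multiset.card_eq_two.1 h
    have ha := hs a (by simp)
    have hb := hs b (by simp)
    simp only [Multiset.insert_eq_cons, Multiset.sum_cons, Multiset.sum_singleton,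
      Multiset.card_cons, Multiset.card_singleton] at hsum
    have ha' : a ≤ 4 := by omega
    have hb' : b ≤ 6 - a := by omega
    interval_cases a <;> interval_cases b <;> decide
  · obtain ⟨a, b, c, rfl⟩ := Multiset.card_eq_three.1 h
    have ha := hs a (by simp)
    have hb := hs b (by simp)
    have hc := hs c (by simp)
    simp only [Multiset.insert_eq_cons, Multiset.sum_cons, Multiset.sum_singleton,
      Multiset.card_cons, Multiset.card_singleton] at hsum
    have ha' : a ≤ 3 := by omega
    have hb' : b ≤ 5 - a := by omega
    have hc' : c ≤ 7 - a - b := by omega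
    interval_cases a <;> interval_cases b <;> interval_cases c <;> decide
  · have h2 : s = Multiset.replicate 4 2 := by
      refine Multiset.eq_replicate.2 ⟨h, fun n hn => ?_⟩
      obtain ⟨t, rfl⟩ := Multiset.exists_cons_of_mem hn
      have h3 := card_le_sum_of_two_le fun m hm => hs m (Multiset.mem_cons_of_mem hm)
      have h4 := hs n hn
      simp only [Multiset.sum_cons, Multiset.card_cons] at hsum h
      omega
    subst h2
    decide

open ProjLine (chart chartU chartV)

/-! ### The strata in a chart -/

/-- The restriction of the form `F` to the lines of a chart, as a polynomial with coefficients in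
the coordinate ring of the chart. The point at infinity is moved by `τ`. -/
noncomputable def familyLine (F : MvPolynomial (Fin 4) ℂ) (σ : Equiv.Perm (Fin 4)) (τ : ℂ) :
    Polynomial (MvPolynomial (Fin 4) ℂ) :=
  aeval (fun i => Polynomial.C (chartU σ X i) +
    Polynomial.C (chartV σ X i + C τ * chartU σ X i) * Polynomial.X) F

theorem map_familyLine (F : MvPolynomial (Fin 4) ℂ) (σ : Equiv.Perm (Fin 4)) (τ : ℂ) (x : AffFour) :
    (familyLine F σ τ).map (AffFour.ev x) =
      alongLine F (chartU σ x.coord) (chartV σ x.coord + τ • chartU σ x.coord) := by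
  rw [familyLine, alongLine, aeval_def, aeval_def, ← Polynomial.coe_mapRingHom, hom_eval₂]
  congr 1
  · ext a
    simp [AffFour.ev]
  · ext i : 1
    have hU : AffFour.ev x (chartU σ X i) = chartU σ x.coord i := by
      rw [ProjLine.map_chartU]
      simp [AffFour.ev]
    have hV : AffFour.ev x (chartV σ X i) = chartV σ x.coord i := by
      rw [ProjLine.map_chartV]
      simp [AffFour.ev]
    have hτ : AffFour.ev x (C τ) = τ := by simp [AffFour.ev]
    rw [Polynomial.coe_mapRingHom, Polynomial.map_add, Polynomial.map_mul, Polynomial.map_C,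
      Polynomial.map_C, Polynomial.map_X, map_add, map_mul, hU, hV, hτ]
    rfl

theorem ev_coeff_familyLine (F : MvPolynomial (Fin 4) ℂ) (σ : Equiv.Perm (Fin 4)) (τ : ℂ)
    (x : AffFour) (j : ℕ) :
    AffFour.ev x ((familyLine F σ τ).coeff j) =
      (alongLine F (chartU σ x.coord) (chartV σ x.coord + τ • chartU σ x.coord)).coeff j := by
  rw [← map_familyLine, Polynomial.coeff_map]

/-! ### The cover of a chart by the roots of the restricted form -/

section Cover

variable {k : ℕ} (d : ℕ) (f : Polynomial (MvPolynomial (Fin 4) ℂ)) (μ : Fin k → ℕ)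

/-- The coefficients of the monic polynomial of degree `d` whose roots are those of `f` scaled by
the coefficient of `f` in degree `d`. -/
noncomputable def normCoeff (j : ℕ) : MvPolynomial (Fin 4) ℂ := f.coeff d ^ (d - 1 - j) * f.coeff j

/-- The equations expressing that the monic polynomial with coefficients `normCoeff d f` is a
product of linear factors with multiplicities `μ`. -/
noncomputable def rootEquations : Finset (MvPolynomial (Fin 4 ⊕ Fin k) ℂ) := by
  classical
  exact (Finset.range d).image fun j =>
    (prodRoots μ fun i => (X (Sum.inr i) : MvPolynomial (Fin 4 ⊕ Fin k) ℂ)).coeff j -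
      rename Sum.inl (normCoeff d f j)

theorem card_rootEquations_le : (rootEquations d f μ).card ≤ d := by
  classical
  rw [rootEquations]
  exact Finset.card_image_le.trans (by simp)

theorem mem_coverImage_rootEquations {x : AffFour} :
    x ∈ AffFour.coverImage (rootEquations d f μ) ↔ ∃ r : Fin k → ℂ, ∀ j < d,
      (prodRoots μ r).coeff j = AffFour.ev x (normCoeff d f j) := by
  classical
  refine exists_congr fun r => ?_
  simp only [rootEquations, Finset.mem_image, Finset.mem_range, forall_exists_index, and_imp,
    forall_apply_eq_imp_iff₂]
  refine forall₂_congr fun j _ => ?_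
  rw [map_sub, sub_eq_zero, eval_rename, Sum.elim_comp_inl, ← Polynomial.coeff_map, map_prodRoots]
  simp only [eval_X, Sum.elim_inr]
  rfl

variable {d μ}

/-- Modulo the equations, the monic polynomial with coefficients `normCoeff d f` becomes `prodRoots
μ`, which vanishes at each of its root variables because every multiplicity is positive. -/
theorem coverMap_rootEquations_isIntegral (hμ : ∀ i, 0 < μ i) (hsum : ∑ i, μ i = d) :
    (AffFour.coverMap (rootEquations d f μ)).IsIntegral := by
  classical
  refine AffFour.coverMap_isIntegral_of _ fun i => ?_
  refine ⟨Polynomial.X ^ d + ∑ j ∈ Finset.range d, Polynomial.C (normCoeff d f j) *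
    Polynomial.X ^ j, ?_, ?_⟩
  · refine Polynomial.monic_X_pow_add (lt_of_le_of_lt (Polynomial.degree_sum_le _ _) ?_)
    refine (Finset.sup_lt_iff (WithBot.bot_lt_coe d)).2 fun j hj => ?_
    exact (Polynomial.degree_C_mul_X_pow_le _ _).trans_lt
      (WithBot.coe_lt_coe.2 (Finset.mem_range.1 hj))
  · set q := Ideal.Quotient.mk
      (Ideal.span (rootEquations d f μ : Set (MvPolynomial (Fin 4 ⊕ Fin k) ℂ)))
    have h1 := eval_prodRoots (R := MvPolynomial (Fin 4 ⊕ Fin k) ℂ) (fun i => X (Sum.inr i)) (hμ i)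
    rw [Polynomial.eval_eq_sum_range, natDegree_prodRoots, hsum, Finset.sum_range_succ] at h1
    have h2 := (prodRoots_monic μ
      fun i => (X (Sum.inr i) : MvPolynomial (Fin 4 ⊕ Fin k) ℂ)).coeff_natDegree
    rw [natDegree_prodRoots, hsum] at h2
    rw [h2, one_mul] at h1
    have h3 := congrArg q h1
    rw [map_zero, map_add, map_sum, add_comm] at h3
    rw [← h3, Polynomial.eval₂_add, Polynomial.eval₂_finsetSum, Polynomial.eval₂_X_pow, map_pow]
    congr 1
    refine Finset.sum_congr rfl fun j hj => ?_
    rw [Polynomial.eval₂_mul, Polynomial.eval₂_C, Polynomial.eval₂_X_pow, map_mul, map_pow]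
    congr 1
    change q (rename Sum.inl (normCoeff d f j)) = _
    symm
    rw [← sub_eq_zero, ← map_sub, Ideal.Quotient.eq_zero_iff_mem]
    refine Ideal.subset_span ?_
    rw [rootEquations]
    exact Finset.mem_coe.2 (Finset.mem_image.2 ⟨j, hj, rfl⟩)

end Cover

/-! ### Closed multiplicity loci in a chart -/

section LocalStructure

variable {d : ℕ} {F : MvPolynomial (Fin 4) ℂ} (hF : F.IsHomogeneous d) (σ : Equiv.Perm (Fin 4))
  (τ : ℂ)

/-- The restriction of `F` to the line of a chart with coordinates `x`. -/
noncomputable abbrev lineRestriction (F : MvPolynomial (Fin 4) ℂ) (σ : Equiv.Perm (Fin 4)) (τ : ℂ)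
    (x : AffFour) : Polynomial ℂ :=
  alongLine F (chartU σ x.coord) (chartV σ x.coord + τ • chartU σ x.coord)

/-- The points of a chart whose line does not meet the surface at infinity. -/
def affineLocus (d : ℕ) (F : MvPolynomial (Fin 4) ℂ) (σ : Equiv.Perm (Fin 4)) (τ : ℂ) :
    Set AffFour :=
  {x | AffFour.ev x ((familyLine F σ τ).coeff d) ≠ 0}

/-- The closure of the locus with multiplicities `μ`. -/
def multLocus {k : ℕ} (d : ℕ) (F : MvPolynomial (Fin 4) ℂ) (σ : Equiv.Perm (Fin 4)) (τ : ℂ)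
    (μ : Fin k → ℕ) : Set AffFour :=
  AffFour.coverImage (rootEquations d (familyLine F σ τ) μ)

/-- The union of the closed loci of the multiplicities with property `p`. -/
def multLocusUnion {k : ℕ} (d : ℕ) (F : MvPolynomial (Fin 4) ℂ) (σ : Equiv.Perm (Fin 4)) (τ : ℂ)
    (p : (Fin k → ℕ) → Prop) : Set AffFour :=
  ⋃ μ ∈ {μ : Fin k → ℕ | (∀ i, 0 < μ i) ∧ ∑ i, μ i = d ∧ p μ}, multLocus d F σ τ μ

theorem isOpen_affineLocus : IsOpen (affineLocus d F σ τ) := AffFour.isOpen_ne_zero _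

theorem isClosed_multLocusUnion {k : ℕ} (p : (Fin k → ℕ) → Prop) :
    IsClosed (multLocusUnion d F σ τ p) := by
  refine Set.Finite.isClosed_biUnion ?_ fun μ hμ =>
    AffFour.isClosed_coverImage _ (coverMap_rootEquations_isIntegral _ hμ.1 hμ.2.1)
  refine (Set.finite_Iic (fun _ : Fin k => d)).subset fun μ hμ i => ?_
  rw [← hμ.2.1]
  exact Finset.single_le_sum (fun _ _ => Nat.zero_le _) (Finset.mem_univ i)

variable {σ τ}

include hF

theorem mem_affineLocus_iff {x : AffFour} : x ∈ affineLocus d F σ τ ↔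
    eval (chartV σ x.coord + τ • chartU σ x.coord) F ≠ 0 := by
  rw [affineLocus, Set.mem_ofPred_eq, ev_coeff_familyLine, coeff_alongLine hF]

theorem mem_multLocus_iff {k : ℕ} {μ : Fin k → ℕ} (hμ : ∑ i, μ i = d) {x : AffFour}
    (hx : x ∈ affineLocus d F σ τ) : x ∈ multLocus d F σ τ μ ↔
      ∃ r : Fin k → ℂ, lineRestriction F σ τ x =
        Polynomial.C ((lineRestriction F σ τ x).coeff d) * prodRoots μ r := by
  have ha : (lineRestriction F σ τ x).coeff d ≠ 0 := by
    rw [← ev_coeff_familyLine]; exact hx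
  rw [multLocus, mem_coverImage_rootEquations]
  have key := fun r => eq_C_mul_prodRoots_iff hμ r
    (natDegree_alongLine_le hF (chartU σ x.coord) (chartV σ x.coord + τ • chartU σ x.coord)) ha
  have hco : ∀ j, AffFour.ev x (normCoeff d (familyLine F σ τ) j) =
      (lineRestriction F σ τ x).coeff d ^ (d - 1 - j) * (lineRestriction F σ τ x).coeff j := by
    intro j
    rw [normCoeff, map_mul, map_pow, ev_coeff_familyLine, ev_coeff_familyLine]
  simp only [hco]
  constructor
  · rintro ⟨r, hr⟩
    exact ⟨_, (key r).1 hr⟩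
  · rintro ⟨r, hr⟩
    refine ⟨fun i => (lineRestriction F σ τ x).coeff d * r i, (key _).2 ?_⟩
    simp only [mul_div_cancel_left₀ _ ha]
    exact hr

theorem mem_multLocusUnion_of_card {k : ℕ} {x : AffFour} (hx : x ∈ affineLocus d F σ τ)
    (hk : (lineRestriction F σ τ x).roots.toFinset.card = k) {p : (Fin k → ℕ) → Prop}
    (hp : ∀ μ, rootPartition (lineRestriction F σ τ x) = Finset.univ.val.map μ → p μ) :
    x ∈ multLocusUnion d F σ τ p := by
  have hx' := (mem_affineLocus_iff hF).1 hx
  obtain ⟨μ, r, -, hμ, hsum, hf, hpart⟩ := exists_eq_C_mul_prodRoots _ hk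
  rw [natDegree_alongLine hF hx'] at hsum
  refine Set.mem_biUnion (x := μ) ⟨hμ, hsum, hp μ hpart⟩ ((mem_multLocus_iff hF hsum hx).2 ⟨r, ?_⟩)
  rwa [Polynomial.leadingCoeff, natDegree_alongLine hF hx'] at hf

/-- A point of the closed locus may have colliding roots, but a collision lowers the number of
distinct roots. With `k` distinct roots the multiplicities are therefore exactly `μ`. -/
theorem card_roots_le_of_mem_multLocus {k : ℕ} {μ : Fin k → ℕ} (hpos : ∀ i, 0 < μ i)
    (hμ : ∑ i, μ i = d) {x : AffFour} (hx : x ∈ affineLocus d F σ τ)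
    (hxm : x ∈ multLocus d F σ τ μ) :
    (lineRestriction F σ τ x).roots.toFinset.card ≤ k ∧
      (k ≤ (lineRestriction F σ τ x).roots.toFinset.card →
        rootPartition (lineRestriction F σ τ x) = Finset.univ.val.map μ) := by
  have ha : (lineRestriction F σ τ x).coeff d ≠ 0 := by
    rw [← ev_coeff_familyLine]; exact hx
  obtain ⟨r, hr⟩ := (mem_multLocus_iff hF hμ hx).1 hxm
  have hcard : (lineRestriction F σ τ x).roots.toFinset = Finset.univ.image r := by
    rw [hr, toFinset_roots_C_mul_prodRoots ha hpos]
  rw [hcard]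
  refine ⟨Finset.card_image_le.trans (by simp), fun hk => ?_⟩
  have hinj : Function.Injective r := by
    rw [← Set.injOn_univ, ← Finset.coe_univ, ← Finset.card_image_iff]
    exact le_antisymm Finset.card_image_le (by simpa using hk)
  rw [hr, rootPartition_C_mul_prodRoots ha hpos hinj]

/-- The open set of points of the chart whose line meets the surface in at least `k` points, all
of them at finite distance. -/
theorem exists_isOpen_card_ge (σ : Equiv.Perm (Fin 4)) (τ : ℂ) (k : ℕ) :
    ∃ O : Set AffFour, IsOpen O ∧ ∀ x, x ∈ O ↔
      x ∈ affineLocus d F σ τ ∧ k ≤ (lineRestriction F σ τ x).roots.toFinset.card := by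
  -- The lines with fewer than `k` points form, inside `affineLocus`, a finite union of closed
  -- multiplicity loci.
  refine ⟨affineLocus d F σ τ ∩ (⋃ j : Fin k,
    multLocusUnion d F σ τ fun _ : Fin j → ℕ => True)ᶜ, (isOpen_affineLocus σ τ).inter
      (isClosed_iUnion_of_finite fun j => isClosed_multLocusUnion σ τ _).isOpen_compl, fun x => ?_⟩
  refine and_congr_right fun hx => ?_
  rw [Set.mem_compl_iff, Set.mem_iUnion, ← not_lt, not_iff_not]
  constructor
  · rintro ⟨j, hj⟩
    obtain ⟨μ, ⟨hpos, hμ, -⟩, hxm⟩ := Set.mem_iUnion₂.1 hj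
    exact (card_roots_le_of_mem_multLocus hF hpos hμ hx hxm).1.trans_lt j.2
  · intro h
    exact ⟨⟨_, h⟩, mem_multLocusUnion_of_card hF hx rfl fun _ _ => trivial⟩

end LocalStructure

/-! ### Strata of a surface without lines -/

namespace Surface

variable {d : ℕ} {X : Surface d} {σ : Equiv.Perm (Fin 4)} {τ : ℂ}

theorem linearIndependent_chart_add_smul (σ : Equiv.Perm (Fin 4)) (τ : ℂ) (x : Fin 4 → ℂ) :
    LinearIndependent ℂ ![chartU σ x, chartV σ x + τ • chartU σ x] := by
  have hind := ProjLine.linearIndependent_chart σ x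
  rw [LinearIndependent.pair_iff] at hind ⊢
  intro s t hst
  have := hind (s + t * τ) t (by
    rw [← hst]
    ext i
    simp
    ring)
  refine ⟨?_, this.2⟩
  simpa [this.2] using this.1

theorem span_chart_add_smul (σ : Equiv.Perm (Fin 4)) (τ : ℂ) (x : AffFour) :
    Submodule.span ℂ {chartU σ x.coord, chartV σ x.coord + τ • chartU σ x.coord} =
      (chart σ x).1 := by
  refine Submodule.eq_of_le_of_finrank_eq ?_ ((ProjLine.finrank_span_pair
    (linearIndependent_chart_add_smul σ τ x.coord)).trans (chart σ x).2.symm)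
  rw [Submodule.span_le]
  rintro w (rfl | rfl)
  · exact Submodule.subset_span (by simp)
  · exact Submodule.mem_span_pair.2 ⟨τ, 1, by rw [one_smul, add_comm]⟩

theorem interPartition_chart {x : AffFour} (hx : x ∈ affineLocus d X.form σ τ) :
    X.interPartition (chart σ x) = rootPartition (lineRestriction X.form σ τ x) :=
  X.interPartition_eq (span_chart_add_smul σ τ x) (linearIndependent_chart_add_smul σ τ x.coord)
    ((mem_affineLocus_iff X.form_isHomogeneous).1 hx)

/-- The points `v + τ u` are all the points of the line except `u`. If the form vanished at every
one of them it would vanish on the line, so some `τ` puts the point at infinity off the surface. -/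
theorem exists_mem_affineLocus {L : ProjLine} (hL : ¬ X.ContainsLine L) :
    ∃ σ τ x, chart σ x = L ∧ x ∈ affineLocus d X.form σ τ := by
  obtain ⟨σ, x, rfl⟩ := ProjLine.exists_chart L
  by_contra hcon
  push Not at hcon
  apply hL
  have h0 : alongLine X.form (chartV σ x.coord) (chartU σ x.coord) = 0 := by
    refine Polynomial.funext fun τ => ?_
    have := hcon σ τ x rfl
    rw [mem_affineLocus_iff X.form_isHomogeneous, not_not] at this
    rw [eval_alongLine, this, Polynomial.eval_zero]
  intro w hw
  refine eval_eq_zero_of_alongLine_eq_zero X.form_isHomogeneous h0 ?_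
  rw [Set.pair_comm]
  exact hw

theorem interPartition_spec {L : ProjLine} (hL : ¬ X.ContainsLine L) :
    (∀ n ∈ X.interPartition L, 0 < n) ∧ (X.interPartition L).sum = d := by
  obtain ⟨σ, τ, x, rfl, hx⟩ := exists_mem_affineLocus hL
  rw [interPartition_chart hx, sum_rootPartition]
  exact ⟨fun n hn => pos_of_mem_rootPartition hn,
    natDegree_alongLine X.form_isHomogeneous ((mem_affineLocus_iff X.form_isHomogeneous).1 hx)⟩

/-- Without the shift by `τ`, the point at infinity may lie on the surface and is then not counted
among the roots, hence only an inequality. This is the direction needed to apply the relations,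
which are stated for numbers of roots. -/
theorem card_roots_le_card_interPartition (σ : Equiv.Perm (Fin 4)) (x : AffFour)
    (hL : ¬ X.ContainsLine (chart σ x)) :
    (alongLine X.form (chartU σ x.coord) (chartV σ x.coord)).roots.toFinset.card ≤
      (X.interPartition (chart σ x)).card := by
  obtain ⟨σ', τ, x', hx', hx⟩ := exists_mem_affineLocus hL
  rw [← hx', interPartition_chart hx, card_rootPartition]
  have hbij := X.bijOn_linePoint (span_chart_add_smul σ' τ x')
    (linearIndependent_chart_add_smul σ' τ x'.coord) ((mem_affineLocus_iff X.form_isHomogeneous).1 hx)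
  have hfin : (X.inter (chart σ' x')).Finite := hbij.image_eq ▸ (Finset.finite_toSet _).image _
  have hcard : (X.inter (chart σ' x')).ncard =
      (lineRestriction X.form σ' τ x').roots.toFinset.card := by
    rw [← hbij.image_eq, hbij.injOn.ncard_image, Set.ncard_coe_finset]
  rw [← hcard, ← Set.ncard_coe_finset]
  have hind := ProjLine.linearIndependent_chart σ x.coord
  refine Set.ncard_le_ncard_of_injOn (linePoint hind) (fun r hr => ?_)
    (linePoint_injective hind).injOn hfin
  rw [hx']
  refine X.linePoint_mem_inter rfl hind ?_
  rw [Finset.mem_coe, Multiset.mem_toFinset] at hr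
  exact Polynomial.isRoot_of_mem_roots hr

variable (hX : ∀ L, ¬ X.ContainsLine L)
include hX

/-- The local structure of a stratum at one of its points. -/
theorem stratum_local {s : Multiset ℕ} {L : ProjLine} (hL : L ∈ X.stratum s) :
    ∃ (σ : Equiv.Perm (Fin 4)) (τ : ℂ) (x : AffFour) (O K : Set AffFour), chart σ x = L ∧ x ∈ O ∧
      IsOpen O ∧ IsClosed K ∧ O ⊆ affineLocus d X.form σ τ ∧
      K = multLocusUnion d X.form σ τ
        (fun μ : Fin (withOnes d s).card → ℕ => Finset.univ.val.map μ = withOnes d s) ∧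
      ∀ y ∈ O, chart σ y ∈ X.stratum s ↔ y ∈ K := by
  obtain ⟨σ, τ, x, rfl, hx⟩ := exists_mem_affineLocus (hX L)
  obtain ⟨O, hO, hmem⟩ := exists_isOpen_card_ge X.form_isHomogeneous σ τ (withOnes d s).card
  refine ⟨σ, τ, x, O, _, rfl, ?_, hO, isClosed_multLocusUnion σ τ _,
    fun y hy => ((hmem y).1 hy).1, rfl, fun y hy => ?_⟩
  · refine (hmem x).2 ⟨hx, ?_⟩
    have h1 : X.interPartition (chart σ x) = withOnes d s := hL
    rw [interPartition_chart hx] at h1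
    rw [← h1, card_rootPartition]
  · obtain ⟨hya, hyk⟩ := (hmem y).1 hy
    have h1 : chart σ y ∈ X.stratum s ↔
      rootPartition (lineRestriction X.form σ τ y) = withOnes d s := by
      rw [← interPartition_chart hya]; rfl
    rw [h1]
    constructor
    · intro h
      refine mem_multLocusUnion_of_card X.form_isHomogeneous hya ?_ fun μ hμ => hμ ▸ h
      rw [← h, card_rootPartition]
    · intro h
      obtain ⟨μ, ⟨hpos, hμ, hμs⟩, hym⟩ := Set.mem_iUnion₂.1 h
      rw [← hμs]
      exact (card_roots_le_of_mem_multLocus X.form_isHomogeneous hpos hμ hya hym).2 hyk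

/-- Being locally closed is local at the points of the set, and near each of them the stratum is
closed in an open subset of a chart. -/
theorem isLocallyClosed_stratum (s : Multiset ℕ) : IsLocallyClosed (X.stratum s) := by
  refine ((isLocallyClosed_tfae (X.stratum s)).out 0 3).2 fun L hL => ?_
  obtain ⟨σ, τ, x, O, K, rfl, hxO, hO, hK, -, -, hOK⟩ := stratum_local hX hL
  have hemb := ProjLine.isOpenEmbedding_chart σ
  refine ⟨chart σ '' O, ⟨x, hxO, rfl⟩, hemb.isOpenMap O hO, ?_⟩
  rintro _ ⟨⟨y, hy, rfl⟩, hyc⟩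
  rw [hOK y hy]
  by_contra hyK
  obtain ⟨_, ⟨z, hz, rfl⟩, hzs⟩ := mem_closure_iff.1 hyc _
    (hemb.isOpenMap (O ∩ Kᶜ) (hO.inter hK.isOpen_compl)) ⟨y, ⟨hy, hyK⟩, rfl⟩
  exact hz.2 ((hOK z hz.1).1 hzs)

/-- With `k` the number of parts, the cover has `4 + k` unknowns and at most `d` equations, and `4 +
k - d = 4 + s.card - s.sum`. The open set `O'` makes the bound local, as is needed for every
irreducible component. -/
theorem le_topologicalKrullDim_stratum_inter {s : Multiset ℕ} {L : ProjLine}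
    (hL : L ∈ X.stratum s) {O' : Set ProjLine} (hO' : IsOpen O') (hLO : L ∈ O') {n : ℕ}
    (hn : n + s.sum ≤ 4 + s.card) :
    n ≤ topologicalKrullDim (X.stratum s ∩ O' : Set ProjLine) := by
  have hsd : s.sum ≤ d := by
    have h1 : X.interPartition L = withOnes d s := hL
    have h2 := (interPartition_spec (hX L)).2
    rw [h1] at h2
    exact sum_withOnes h2
  have hcard := card_withOnes hsd
  obtain ⟨σ, τ, x, O, K, rfl, hxO, hO, hK, -, hKeq, hOK⟩ := stratum_local hX hL
  have hxK : x ∈ K := (hOK x hxO).1 hL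
  rw [hKeq] at hxK
  obtain ⟨μ, hμ, hxm⟩ := Set.mem_iUnion₂.1 hxK
  have hcont := ProjLine.continuous_chart σ
  have h1 := AffFour.le_topologicalKrullDim_coverImage _
    (coverMap_rootEquations_isIntegral (familyLine X.form σ τ) hμ.1 hμ.2.1)
    (hO.inter (hO'.preimage hcont)) hxm ⟨hxO, hLO⟩ (n := n)
    (by
      have := card_rootEquations_le d (familyLine X.form σ τ) μ
      omega)
  refine h1.trans (le_trans ?_ (ProjLine.topologicalKrullDim_chart_preimage_le σ _))
  have hsub : AffFour.coverImage (rootEquations d (familyLine X.form σ τ) μ) ∩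
      (O ∩ chart σ ⁻¹' O') ⊆ chart σ ⁻¹' (X.stratum s ∩ O') := by
    rintro y ⟨hy, hyO, hyO'⟩
    refine ⟨(hOK y hyO).2 ?_, hyO'⟩
    rw [hKeq]
    exact Set.mem_biUnion hμ hy
  exact (IsEmbedding.inclusion hsub).isInducing.topologicalKrullDim_le

/-- Having `d` points is the same as having at least `d` points, which is an open condition. -/
theorem isOpen_stratum_zero : IsOpen (X.stratum 0) := by
  rw [isOpen_iff_forall_mem_open]
  intro L hL
  obtain ⟨σ, τ, x, rfl, hx⟩ := exists_mem_affineLocus (hX L)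
  obtain ⟨O, hO, hmem⟩ := exists_isOpen_card_ge X.form_isHomogeneous σ τ d
  have key : ∀ y ∈ affineLocus d X.form σ τ, y ∈ O ↔ chart σ y ∈ X.stratum 0 := by
    intro y hy
    have h1 : chart σ y ∈ X.stratum 0 ↔
      rootPartition (lineRestriction X.form σ τ y) = withOnes d 0 := by
      rw [← interPartition_chart hy]; rfl
    have hspec := interPartition_spec (hX (chart σ y))
    rw [interPartition_chart hy] at hspec
    rw [h1, hmem, and_iff_right hy, ← card_rootPartition]
    constructor
    · intro h
      obtain ⟨s, hs2, hs, hs3⟩ := exists_eq_withOnes hspec.1 hspec.2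
      have := card_le_sum_of_two_le hs2
      have hs0 : s = 0 := Multiset.card_eq_zero.1 (by omega)
      rw [hs, hs0]
    · intro h
      rw [h]
      simp [withOnes]
  refine ⟨chart σ '' O, ?_, (ProjLine.isOpenEmbedding_chart σ).isOpenMap O hO,
    ⟨x, (key x hx).2 hL, rfl⟩⟩
  rintro _ ⟨y, hy, rfl⟩
  exact (key y ((hmem y).1 hy).1).1 hy

end Surface

/-! ### Forms parametrized by a line and their restriction to it -/

/-- The exponents of the quaternary monomials of degree `d`. -/
abbrev Mon (d : ℕ) : Type := (Finset.univ : Finset (Fin 4)).finsuppAntidiag d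

theorem mem_mon {d : ℕ} {m : Fin 4 →₀ ℕ} :
    m ∈ (Finset.univ : Finset (Fin 4)).finsuppAntidiag d ↔ ∑ i, m i = d := by
  simp

theorem sum_eq_of_coeff_ne_zero {R : Type*} [CommRing R] {d : ℕ} {F : MvPolynomial (Fin 4) R}
    (hF : F.IsHomogeneous d) {m : Fin 4 →₀ ℕ} (hm : coeff m F ≠ 0) : ∑ i, m i = d := by
  have := hF hm
  rw [Finsupp.weight_apply, Finsupp.sum_fintype _ _ (fun _ => by simp)] at this
  simpa using this

/-- The exponents of the monomials of degree `d` that vanish on the coordinate line of a chart. -/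
abbrev MonOff (d : ℕ) (σ : Equiv.Perm (Fin 4)) : Type :=
  ((Finset.univ : Finset (Fin 4)).finsuppAntidiag d).filter fun m => m (σ 2) + m (σ 3) ≠ 0

/-- The exponent of a monomial that does not vanish on the coordinate line of a chart. -/
noncomputable def monOn (d : ℕ) (σ : Equiv.Perm (Fin 4)) (j : ℕ) : Fin 4 →₀ ℕ :=
  Finsupp.single (σ 0) (d - j) + Finsupp.single (σ 1) j

theorem sum_perm {M : Type*} [AddCommMonoid M] (σ : Equiv.Perm (Fin 4)) (f : Fin 4 → M) :
    ∑ i, f i = f (σ 0) + f (σ 1) + f (σ 2) + f (σ 3) := by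
  rw [← Equiv.sum_comp σ, Fin.sum_univ_four]

theorem prod_perm {M : Type*} [CommMonoid M] (σ : Equiv.Perm (Fin 4)) (f : Fin 4 → M) :
    ∏ i, f i = f (σ 0) * f (σ 1) * f (σ 2) * f (σ 3) := by
  rw [← Equiv.prod_comp σ, Fin.prod_univ_four]

theorem monOn_zero (d : ℕ) (σ : Equiv.Perm (Fin 4)) (j : ℕ) : monOn d σ j (σ 0) = d - j := by
  simp [monOn]

theorem monOn_one (d : ℕ) (σ : Equiv.Perm (Fin 4)) (j : ℕ) : monOn d σ j (σ 1) = j := by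
  simp [monOn]

theorem monOn_two (d : ℕ) (σ : Equiv.Perm (Fin 4)) (j : ℕ) : monOn d σ j (σ 2) = 0 := by
  simp [monOn]

theorem monOn_three (d : ℕ) (σ : Equiv.Perm (Fin 4)) (j : ℕ) : monOn d σ j (σ 3) = 0 := by
  simp [monOn]

theorem eq_monOn {d : ℕ} {σ : Equiv.Perm (Fin 4)} {m : Fin 4 →₀ ℕ} (hm : ∑ i, m i = d)
    (h : m (σ 2) + m (σ 3) = 0) : m = monOn d σ (m (σ 1)) := by
  rw [sum_perm σ] at hm
  ext i
  obtain ⟨j, rfl⟩ := σ.surjective i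
  fin_cases j
  · change m (σ 0) = monOn d σ _ (σ 0)
    rw [monOn_zero]
    omega
  · change m (σ 1) = monOn d σ _ (σ 1)
    rw [monOn_one]
  · change m (σ 2) = monOn d σ _ (σ 2)
    rw [monOn_two]
    omega
  · change m (σ 3) = monOn d σ _ (σ 3)
    rw [monOn_three]
    omega

/-- The `d + 1` monomials in the two coordinates of the line are the ones left out. This is the gain
in the parameter count. -/
theorem card_monOff_add_le (d : ℕ) (σ : Equiv.Perm (Fin 4)) :
    Fintype.card (MonOff d σ) + (d + 1) ≤ Fintype.card (Mon d) := by
  rw [Fintype.card_coe, Fintype.card_coe,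
    ← Finset.card_filter_add_card_filter_not (s := (Finset.univ : Finset (Fin 4)).finsuppAntidiag d)
      (fun m => m (σ 2) + m (σ 3) ≠ 0)]
  refine Nat.add_le_add_left ?_ _
  have := Finset.card_le_card_of_injOn (s := Finset.range (d + 1))
    (t := ((Finset.univ : Finset (Fin 4)).finsuppAntidiag d).filter
      fun m => ¬ (m (σ 2) + m (σ 3) ≠ 0)) (monOn d σ) (fun j hj => ?_) (fun i _ j _ hij => ?_)
  · simpa using this
  · rw [Finset.mem_coe, Finset.mem_range] at hj
    rw [Finset.mem_coe, Finset.mem_filter, mem_mon, sum_perm σ, monOn_zero, monOn_one, monOn_two,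
      monOn_three]
    omega
  · rw [← monOn_one d σ i, hij, monOn_one]

/-- The linear change of coordinates moving the line of a chart with coordinates `-x` to the
coordinate line. -/
noncomputable def shear {R : Type*} [CommRing R] (σ : Equiv.Perm (Fin 4)) (x : Fin 4 → R)
    (i : Fin 4) : MvPolynomial (Fin 4) R :=
  X i + C (![0, 0, x 0, x 1] (σ.symm i)) * X (σ 0) + C (![0, 0, x 2, x 3] (σ.symm i)) * X (σ 1)

theorem shear_zero {R : Type*} [CommRing R] (σ : Equiv.Perm (Fin 4)) (x : Fin 4 → R) :
    shear σ x (σ 0) = X (σ 0) := by simp [shear]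

theorem shear_one {R : Type*} [CommRing R] (σ : Equiv.Perm (Fin 4)) (x : Fin 4 → R) :
    shear σ x (σ 1) = X (σ 1) := by simp [shear]

theorem shear_two {R : Type*} [CommRing R] (σ : Equiv.Perm (Fin 4)) (x : Fin 4 → R) :
    shear σ x (σ 2) = X (σ 2) + C (x 0) * X (σ 0) + C (x 2) * X (σ 1) := by simp [shear]

theorem shear_three {R : Type*} [CommRing R] (σ : Equiv.Perm (Fin 4)) (x : Fin 4 → R) :
    shear σ x (σ 3) = X (σ 3) + C (x 1) * X (σ 0) + C (x 3) * X (σ 1) := by simp [shear]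

theorem aeval_shear_neg (σ : Equiv.Perm (Fin 4)) (x : Fin 4 → ℂ) (F : MvPolynomial (Fin 4) ℂ) :
    aeval (shear σ (-x)) (aeval (shear σ x) F) = F := by
  rw [← AlgHom.comp_apply]
  conv_rhs => rw [← AlgHom.id_apply (R := ℂ) F]
  congr 1
  ext i : 1
  obtain ⟨j, rfl⟩ := σ.surjective i
  fin_cases j
  · simp [shear_zero]
  · simp [shear_one]
  · change aeval (shear σ (-x)) (aeval (shear σ x) (X (σ 2))) = X (σ 2)
    simp only [aeval_X, shear_two, map_add, map_mul, algHom_C, shear_zero, shear_one,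
      Pi.neg_apply, map_neg, algebraMap_eq]
    ring
  · change aeval (shear σ (-x)) (aeval (shear σ x) (X (σ 3))) = X (σ 3)
    simp only [aeval_X, shear_three, map_add, map_mul, algHom_C, shear_zero, shear_one,
      Pi.neg_apply, map_neg, algebraMap_eq]
    ring

theorem isHomogeneous_shear (σ : Equiv.Perm (Fin 4)) (x : Fin 4 → ℂ) (i : Fin 4) :
    (shear σ x i).IsHomogeneous 1 := by
  refine ((isHomogeneous_X _ _).add ?_).add ?_
  · simpa using (isHomogeneous_C (Fin 4) _).mul (isHomogeneous_X ℂ (σ 0))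
  · simpa using (isHomogeneous_C (Fin 4) _).mul (isHomogeneous_X ℂ (σ 1))

theorem coeff_monOn {d : ℕ} {G : MvPolynomial (Fin 4) ℂ} (hG : G.IsHomogeneous d)
    (σ : Equiv.Perm (Fin 4)) {j : ℕ} (hj : j ≤ d) :
    coeff (monOn d σ j) G = (alongLine G (chartU σ 0) (chartV σ 0)).coeff j := by
  rw [alongLine, aeval_def, eval₂_eq', Polynomial.finsetSum_coeff]
  rw [Finset.sum_eq_single (monOn d σ j)]
  · rw [prod_perm σ]
    simp [monOn_zero, monOn_one, monOn_two, monOn_three, Polynomial.coeff_X_pow]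
  · intro m hm hne
    rw [prod_perm σ]
    by_cases h : m (σ 2) + m (σ 3) = 0
    · have hm' := eq_monOn (sum_eq_of_coeff_ne_zero hG (mem_support_iff.1 hm)) h
      have hne' : j ≠ m (σ 1) := by
        rintro rfl
        exact hne hm'
      have h2 : m (σ 2) = 0 := by omega
      have h3 : m (σ 3) = 0 := by omega
      simp [h2, h3, Polynomial.coeff_X_pow, hne']
    · rcases Nat.eq_zero_or_pos (m (σ 2)) with h2 | h2
      · have h3 : m (σ 3) ≠ 0 := by omega
        simp [h3]
      · simp [h2.ne']
  · intro hm
    simp [notMem_support_iff.1 hm]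

theorem alongLine_shear (F : MvPolynomial (Fin 4) ℂ) (σ : Equiv.Perm (Fin 4)) (x : Fin 4 → ℂ) :
    alongLine (aeval (shear σ x) F) (chartU σ 0) (chartV σ 0) =
      alongLine F (chartU σ x) (chartV σ x) := by
  rw [alongLine, alongLine, ← AlgHom.comp_apply]
  congr 1
  ext i : 1
  obtain ⟨j, rfl⟩ := σ.surjective i
  fin_cases j
  · simp [shear_zero]
  · simp [shear_one]
  · simp [shear_two]
  · simp [shear_three]

section Parametrization

variable {d n : ℕ} (σ : Equiv.Perm (Fin 4)) (c : ℕ → MvPolynomial (Fin n) ℂ)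

/-- The variables of the parametrization: the coordinates of the line, the coefficients of the form
off the line, and the parameters for the restriction to the line. -/
abbrev ParamVar (d n : ℕ) (σ : Equiv.Perm (Fin 4)) : Type := Fin 4 ⊕ (MonOff d σ ⊕ Fin n)

/-- The universal form in coordinates adapted to the line. -/
noncomputable def universalForm (d : ℕ) (σ : Equiv.Perm (Fin 4)) (c : ℕ → MvPolynomial (Fin n) ℂ) :
    MvPolynomial (Fin 4) (MvPolynomial (ParamVar d n σ) ℂ) :=
  ∑ m : MonOff d σ, monomial m.1 (X (Sum.inr (Sum.inl m))) +
    ∑ j ∈ Finset.range (d + 1),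
      monomial (monOn d σ j) (rename (fun i => Sum.inr (Sum.inr i)) (c j))

/-- The universal form in the standard coordinates. -/
noncomputable def universalForm' (d : ℕ) (σ : Equiv.Perm (Fin 4))
    (c : ℕ → MvPolynomial (Fin n) ℂ) :
    MvPolynomial (Fin 4) (MvPolynomial (ParamVar d n σ) ℂ) :=
  aeval (shear σ fun i => -X (Sum.inl i)) (universalForm d σ c)

/-- Shear the line to the coordinate line. There the monomials vanishing on the line have free
coefficients, while the others have as coefficients those of the restriction, prescribed by `c`. The
opposite shear recovers `F`. -/
theorem exists_param {F : MvPolynomial (Fin 4) ℂ} (hF : F.IsHomogeneous d) (x : Fin 4 → ℂ)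
    (y : Fin n → ℂ)
    (h : ∀ j ≤ d, (alongLine F (chartU σ x) (chartV σ x)).coeff j = eval y (c j)) :
    ∃ z : ParamVar d n σ → ℂ, (∀ i, z (Sum.inl i) = x i) ∧
      ∀ m, coeff m F = eval z (coeff m (universalForm' d σ c)) := by
  set G : MvPolynomial (Fin 4) ℂ := aeval (shear σ x) F with hGdef
  have hG : G.IsHomogeneous d := by
    have := hF.aeval _ (isHomogeneous_shear σ x)
    rwa [one_mul] at this
  let z : ParamVar d n σ → ℂ := Sum.elim x (Sum.elim (fun m => coeff m.1 G) y)
  have hzG : map (eval z) (universalForm d σ c) = G := by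
    ext m
    rw [coeff_map, universalForm, coeff_add, map_add, coeff_sum, coeff_sum, map_sum, map_sum]
    simp only [coeff_monomial, apply_ite (eval z), map_zero, eval_X, eval_rename]
    have hz2 : (z ∘ fun i => Sum.inr (Sum.inr i)) = y := rfl
    simp only [hz2]
    by_cases hm : ∑ i, m i = d
    · by_cases hoff : m (σ 2) + m (σ 3) = 0
      · rw [Finset.sum_eq_zero, zero_add, Finset.sum_eq_single (m (σ 1)),
          if_pos (eq_monOn hm hoff).symm, eq_monOn hm hoff, monOn_one, coeff_monOn hG,
          hGdef, alongLine_shear, h]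
        · rw [sum_perm σ] at hm; omega
        · rw [sum_perm σ] at hm; omega
        · intro j _ hj
          rw [if_neg]
          rintro rfl
          exact hj (monOn_one d σ j).symm
        · intro hcon
          rw [Finset.mem_range] at hcon
          rw [sum_perm σ] at hm
          omega
        · intro m' _
          rw [if_neg]
          intro heq
          have := (Finset.mem_filter.1 m'.2).2
          rw [heq] at this
          exact this hoff
      · have hmem : m ∈ ((Finset.univ : Finset (Fin 4)).finsuppAntidiag d).filter
            fun m => m (σ 2) + m (σ 3) ≠ 0 := Finset.mem_filter.2 ⟨mem_mon.2 hm, hoff⟩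
        rw [Finset.sum_eq_single (⟨m, hmem⟩ : MonOff d σ), if_pos rfl, Finset.sum_eq_zero, add_zero]
        · rfl
        · intro j _
          rw [if_neg]
          rintro rfl
          exact hoff (by rw [monOn_two, monOn_three])
        · intro m' _ hm'
          rw [if_neg]
          intro heq
          exact hm' (Subtype.ext heq)
        · simp
    · rw [Finset.sum_eq_zero, Finset.sum_eq_zero, add_zero]
      · by_contra hne
        exact hm (sum_eq_of_coeff_ne_zero hG (Ne.symm hne))
      · intro j hj
        rw [Finset.mem_range] at hj
        rw [if_neg]
        rintro rfl
        rw [sum_perm σ, monOn_zero, monOn_one, monOn_two, monOn_three] at hm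
        omega
      · intro m' _
        rw [if_neg]
        intro heq
        have := mem_mon.1 (Finset.mem_filter.1 m'.2).1
        rw [heq] at this
        exact hm this
  have hzF : map (eval z) (universalForm' d σ c) = F := by
    rw [← aeval_shear_neg σ x F, ← hGdef, ← hzG, universalForm', aeval_def, aeval_def,
      hom_eval₂, eval₂_map]
    congr 1
    · ext <;> simp
    · ext i : 1
      obtain ⟨j, rfl⟩ := σ.surjective i
      fin_cases j <;> simp [shear, z]
  refine ⟨z, fun i => rfl, fun m => ?_⟩
  rw [← coeff_map, hzF]

theorem eval₂_sumAlgEquiv {κ ρ : Type*} (a : κ → ℂ) (b : ρ → ℂ) (Q : MvPolynomial (κ ⊕ ρ) ℂ) :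
    eval₂ (eval b) a (sumAlgEquiv ℂ κ ρ Q) = eval (Sum.elim a b) Q := by
  induction Q using MvPolynomial.induction_on with
  | C a => simp
  | add p q hp hq => rw [map_add, eval₂_add, hp, hq, map_add]
  | mul_X p i hp =>
    rw [map_mul, eval₂_mul, hp, map_mul]
    rcases i with i | i <;> simp

/-- The `p` chosen coordinates and all the coefficients of the universal form are more polynomials
than there are parameters, so they are algebraically dependent. Specializing the coefficients in a
dependence gives `q`. -/
theorem exists_relation {p : ℕ} (ι : Fin p → Fin 4) (hp : 4 + n < d + 1 + p) :
    ∃ D : MvPolynomial (Mon d) ℂ, D ≠ 0 ∧ ∀ F : MvPolynomial (Fin 4) ℂ, F.IsHomogeneous d →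
      eval (fun m : Mon d => coeff m.1 F) D ≠ 0 → ∃ q : MvPolynomial (Fin p) ℂ, q ≠ 0 ∧
        ∀ (x : Fin 4 → ℂ) (y : Fin n → ℂ),
          (∀ j ≤ d, (alongLine F (chartU σ x) (chartV σ x)).coeff j = eval y (c j)) →
            eval (x ∘ ι) q = 0 := by
  let fam : Fin p ⊕ Mon d → MvPolynomial (ParamVar d n σ) ℂ :=
    Sum.elim (fun i => X (Sum.inl (ι i))) fun m => coeff m.1 (universalForm' d σ c)
  have hdep : ¬ AlgebraicIndependent ℂ fam := by
    intro hind
    have h1 := hind.lift_cardinalMk_le_trdeg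
    rw [MvPolynomial.trdeg_of_isDomain] at h1
    simp only [Cardinal.mk_fintype, Cardinal.lift_natCast, Nat.cast_le, Fintype.card_sum,
      Fintype.card_fin] at h1
    have h2 := card_monOff_add_le d σ
    omega
  have hQ : ∃ Q : MvPolynomial (Fin p ⊕ Mon d) ℂ, aeval fam Q = 0 ∧ Q ≠ 0 := by
    by_contra hcon
    push Not at hcon
    exact hdep ((injective_iff_map_eq_zero _).2 hcon)
  obtain ⟨Q, hQ, hQ0⟩ := hQ
  set Q' := sumAlgEquiv ℂ (Fin p) (Mon d) Q with hQ'
  have hQ'0 : Q' ≠ 0 := (map_ne_zero_iff _ (AlgEquiv.injective _)).2 hQ0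
  -- The dependence is read as a polynomial in the `p` coordinates. One nonzero coefficient of it
  -- serves as `D`: where `D` does not vanish, the specialization is nonzero.
  obtain ⟨m, hm⟩ := ne_zero_iff.1 hQ'0
  refine ⟨coeff m Q', hm, fun F hF hD => ⟨map (eval fun m : Mon d => coeff m.1 F) Q', ?_, ?_⟩⟩
  · intro h0
    apply hD
    rw [← coeff_map, h0, coeff_zero]
  · intro x y hxy
    obtain ⟨z, hzx, hz⟩ := exists_param σ c hF x y hxy
    have h1 : eval (x ∘ ι) (map (eval fun m : Mon d => coeff m.1 F) Q') =
        eval (Sum.elim (x ∘ ι) fun m : Mon d => coeff m.1 F) Q := by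
      rw [eval_map, hQ', eval₂_sumAlgEquiv]
    have h2 : eval z (aeval fam Q) = eval (Sum.elim (x ∘ ι) fun m : Mon d => coeff m.1 F) Q := by
      rw [aeval_def, hom_eval₂, eval, ← coe_eval₂Hom]
      congr 1
      refine congrArg₂ _ (by ext; simp) ?_
      ext (i | m)
      · simp [fam, hzx]
      · simp [fam, hz]
    rw [h1, ← h2, hQ, map_zero]

end Parametrization

/-! ### Generic surfaces -/

theorem exists_relation_of_card_roots_le {d k p : ℕ} (σ : Equiv.Perm (Fin 4)) (ι : Fin p → Fin 4)
    (hk : k + 5 ≤ d + p) :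
    ∃ D : MvPolynomial (Mon d) ℂ, D ≠ 0 ∧ ∀ F : MvPolynomial (Fin 4) ℂ, F.IsHomogeneous d →
      eval (fun m : Mon d => coeff m.1 F) D ≠ 0 → ∃ q : MvPolynomial (Fin p) ℂ, q ≠ 0 ∧
        ∀ x : Fin 4 → ℂ, (alongLine F (chartU σ x) (chartV σ x)).roots.toFinset.card ≤ k →
          eval (x ∘ ι) q = 0 := by
  -- One relation for each of the finitely many multiplicity patterns with `j ≤ k` roots. Its `j +
  -- 1` parameters are the roots and, last, the leading coefficient. A zero restriction is covered
  -- by `j = 0`.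
  have h := fun i : Σ j : Fin (k + 1), (Fin j → Fin (d + 1)) =>
    exists_relation (d := d) σ (fun j => (Polynomial.C (X (Fin.last i.1.1)) *
      prodRoots (fun l => (i.2 l : ℕ)) fun l : Fin i.1.1 =>
        (X l.castSucc : MvPolynomial (Fin (i.1.1 + 1)) ℂ)).coeff j) ι
      (by have := i.1.2; omega)
  choose D hD0 hD using h
  refine ⟨∏ i, D i, Finset.prod_ne_zero_iff.2 fun i _ => hD0 i, fun F hF hF0 => ?_⟩
  rw [map_prod] at hF0
  have h' := fun i => hD i F hF (Finset.prod_ne_zero_iff.1 hF0 i (Finset.mem_univ i))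
  choose q hq0 hq using h'
  refine ⟨∏ i, q i, Finset.prod_ne_zero_iff.2 fun i _ => hq0 i, fun x hx => ?_⟩
  obtain ⟨μ, r, -, -, hsum, hf, -⟩ := exists_eq_C_mul_prodRoots
    (alongLine F (chartU σ x) (chartV σ x)) rfl
  have hμ : ∀ i, μ i < d + 1 := fun i => by
    have h1 := Finset.single_le_sum (f := μ) (fun _ _ => Nat.zero_le _) (Finset.mem_univ i)
    have h2 := natDegree_alongLine_le hF (chartU σ x) (chartV σ x)
    omega
  let i : Σ j : Fin (k + 1), (Fin j → Fin (d + 1)) :=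
    ⟨⟨_, Nat.lt_succ_iff.2 hx⟩, fun l => ⟨μ l, hμ l⟩⟩
  rw [map_prod]
  refine Finset.prod_eq_zero (Finset.mem_univ i) ?_
  refine hq i x (Fin.snoc r (alongLine F (chartU σ x) (chartV σ x)).leadingCoeff) fun j _ => ?_
  rw [← Polynomial.coeff_map, Polynomial.map_mul, Polynomial.map_C, map_prodRoots]
  simp only [eval_X, Fin.snoc_last, Fin.snoc_castSucc]
  conv_lhs => rw [hf]

/-- Containing a line imposes `d + 1 > 4` conditions. In the case `p = 0` the relation is a nonzero
constant, so no line can satisfy the hypothesis. -/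
theorem exists_alongLine_ne_zero {d : ℕ} (hd : 4 ≤ d) (σ : Equiv.Perm (Fin 4)) :
    ∃ D : MvPolynomial (Mon d) ℂ, D ≠ 0 ∧ ∀ F : MvPolynomial (Fin 4) ℂ, F.IsHomogeneous d →
      eval (fun m : Mon d => coeff m.1 F) D ≠ 0 →
        ∀ x : Fin 4 → ℂ, alongLine F (chartU σ x) (chartV σ x) ≠ 0 := by
  obtain ⟨D, hD0, hD⟩ := exists_relation (d := d) (n := 0) (p := 0) σ 0 Fin.elim0 (by omega)
  refine ⟨D, hD0, fun F hF hF0 x hx => ?_⟩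
  obtain ⟨q, hq0, hq⟩ := hD F hF hF0
  have h1 := hq x 0 fun j _ => by simp [hx]
  rw [eq_C_of_isEmpty q, eval_C] at h1
  rw [eq_C_of_isEmpty q, h1, C_0] at hq0
  exact hq0 rfl

theorem exists_generic {d : ℕ} (hd : 4 ≤ d) :
    ∃ D : MvPolynomial (Mon d) ℂ, D ≠ 0 ∧ ∀ F : MvPolynomial (Fin 4) ℂ, F.IsHomogeneous d →
      eval (fun m : Mon d => coeff m.1 F) D ≠ 0 → ∀ σ : Equiv.Perm (Fin 4),
        (∀ x : Fin 4 → ℂ, alongLine F (chartU σ x) (chartV σ x) ≠ 0) ∧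
        ∀ p ≤ 4, ∀ (ι : Fin p → Fin 4), 5 ≤ d + p →
          ∃ q : MvPolynomial (Fin p) ℂ, q ≠ 0 ∧ ∀ x : Fin 4 → ℂ,
            (alongLine F (chartU σ x) (chartV σ x)).roots.toFinset.card + 5 ≤ d + p →
              eval (x ∘ ι) q = 0 := by
  choose D₁ hD₁0 hD₁ using exists_alongLine_ne_zero hd
  have h : ∀ i : Σ (_ : Equiv.Perm (Fin 4)) (p : Fin 5), (Fin p → Fin 4),
      ∃ D : MvPolynomial (Mon d) ℂ, D ≠ 0 ∧ (5 ≤ d + i.2.1 →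
        ∀ F : MvPolynomial (Fin 4) ℂ, F.IsHomogeneous d →
        eval (fun m : Mon d => coeff m.1 F) D ≠ 0 → ∃ q : MvPolynomial (Fin i.2.1) ℂ, q ≠ 0 ∧
        ∀ x : Fin 4 → ℂ, (alongLine F (chartU i.1 x) (chartV i.1 x)).roots.toFinset.card ≤
          d + i.2.1 - 5 → eval (x ∘ i.2.2) q = 0) := by
    rintro ⟨σ, p, ι⟩
    by_cases hp : 5 ≤ d + p
    · obtain ⟨D, hD0, hD⟩ := exists_relation_of_card_roots_le (d := d) (k := d + p - 5) σ ι
        (by omega)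
      exact ⟨D, hD0, fun _ => hD⟩
    · exact ⟨1, one_ne_zero, fun h => absurd h hp⟩
  choose D₂ hD₂0 hD₂ using h
  refine ⟨(∏ σ, D₁ σ) * ∏ i, D₂ i, mul_ne_zero (Finset.prod_ne_zero_iff.2 fun i _ => hD₁0 i)
    (Finset.prod_ne_zero_iff.2 fun i _ => hD₂0 i), fun F hF hF0 σ => ⟨?_, ?_⟩⟩
  · rw [map_mul, map_prod, map_prod] at hF0
    exact hD₁ σ F hF (Finset.prod_ne_zero_iff.1 (left_ne_zero_of_mul hF0) σ (Finset.mem_univ σ))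
  · intro p hp ι hdp
    rw [map_mul, map_prod, map_prod] at hF0
    have hp' : p < 5 := by omega
    obtain ⟨q, hq0, hq⟩ := hD₂ ⟨σ, ⟨p, hp'⟩, ι⟩ hdp F hF
      (Finset.prod_ne_zero_iff.1 (right_ne_zero_of_mul hF0) _ (Finset.mem_univ _))
    exact ⟨q, hq0, fun x hx => hq x (Nat.le_sub_of_add_le hx)⟩

theorem exists_eval_ne_zero {κ : Type*} {D : MvPolynomial κ ℂ} (hD : D ≠ 0) :
    ∃ c : κ → ℂ, eval c D ≠ 0 := by
  by_contra hcon
  push Not at hcon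
  exact hD (MvPolynomial.funext fun c => by rw [hcon c, map_zero])

/-- Genericity on the projective space must be tested by a homogeneous polynomial, while `D` is
arbitrary. As a polynomial in `s`, `D (s c)` has the values of the homogeneous components as
coefficients, so one nonzero component is enough after rescaling. -/
theorem exists_smul_eval_ne_zero {κ : Type*} {D : MvPolynomial κ ℂ} {c : κ → ℂ} {j : ℕ}
    (h : eval c (homogeneousComponent j D) ≠ 0) : ∃ s : ℂ, s ≠ 0 ∧ eval (s • c) D ≠ 0 := by
  let P : Polynomial ℂ := ∑ i ∈ Finset.range (D.totalDegree + 1),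
    Polynomial.C (eval c (homogeneousComponent i D)) * Polynomial.X ^ i
  have hj : j < D.totalDegree + 1 := by
    by_contra hj
    rw [homogeneousComponent_eq_zero _ _ (by omega), map_zero] at h
    exact h rfl
  have hP : P ≠ 0 := by
    intro h0
    have := congrArg (fun p => Polynomial.coeff p j) h0
    simp only [P, Polynomial.finsetSum_coeff, Polynomial.coeff_C_mul_X_pow,
      Polynomial.coeff_zero] at this
    rw [Finset.sum_eq_single j] at this
    · exact h (by simpa using this)
    · intro i _ hi
      rw [if_neg (Ne.symm hi)]
    · intro hcon
      exact absurd (Finset.mem_range.2 hj) hcon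
  -- The factor `X` forces the scalar found below to be nonzero.
  have hXP : Polynomial.X * P ≠ 0 := mul_ne_zero Polynomial.X_ne_zero hP
  have : ∃ s, (Polynomial.X * P).eval s ≠ 0 := by
    by_contra hcon
    push Not at hcon
    exact hXP (Polynomial.funext fun s => by rw [hcon s, Polynomial.eval_zero])
  obtain ⟨s, hs⟩ := this
  rw [Polynomial.eval_mul, Polynomial.eval_X] at hs
  refine ⟨s, left_ne_zero_of_mul hs, ?_⟩
  have hDs : eval (s • c) D = P.eval s := by
    conv_lhs => rw [← sum_homogeneousComponent D]
    rw [map_sum, Polynomial.eval_finsetSum]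
    refine Finset.sum_congr rfl fun i _ => ?_
    rw [(homogeneousComponent_isHomogeneous i D).eval_smul_eq, Polynomial.eval_mul, Polynomial.eval_C,
      Polynomial.eval_pow, Polynomial.eval_X, mul_comm]
  rw [hDs]
  exact right_ne_zero_of_mul hs

theorem Surface.exists_isOpen_generic {d : ℕ} {D : MvPolynomial (Mon d) ℂ} (hD : D ≠ 0) :
    ∃ U : Set (Surface d), IsOpen U ∧ U.Nonempty ∧ ∀ X ∈ U, ∃ s : ℂ, s ≠ 0 ∧
      eval (fun m : Mon d => coeff m.1 (C s * X.form)) D ≠ 0 := by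
  have hj : ∃ j, homogeneousComponent j D ≠ 0 := by
    by_contra hcon
    push Not at hcon
    apply hD
    rw [← sum_homogeneousComponent D]
    exact Finset.sum_eq_zero fun i _ => hcon i
  obtain ⟨j, hj⟩ := hj
  set E := homogeneousComponent j D with hE
  have hEhom : E.IsHomogeneous j := homogeneousComponent_isHomogeneous j D
  have hev : ∀ F : MvPolynomial (Fin 4) ℂ, eval (fun m => coeff m F) (rename Subtype.val E) =
      eval (fun m : Mon d => coeff m.1 F) E := fun F => eval_rename _ _ _
  refine ⟨{X | eval (fun m => X.form.coeff m) (rename Subtype.val E) ≠ 0}, ?_, ?_, ?_⟩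
  · exact isOpen_generateFrom_of_mem ⟨j, _, hEhom.rename_isHomogeneous, rfl⟩
  · let m₀ : Mon d := ⟨Finsupp.single 0 d, by simp [Finsupp.single_apply]⟩
    -- The factor `X m₀` guarantees a nonzero form, even when `E` is constant.
    obtain ⟨c, hc⟩ := exists_eval_ne_zero (mul_ne_zero hj (X_ne_zero (R := ℂ) m₀))
    rw [map_mul, eval_X] at hc
    let F : MvPolynomial (Fin 4) ℂ := ∑ m : Mon d, monomial m.1 (c m)
    have hcoeff : ∀ m : Mon d, coeff m.1 F = c m := by
      intro m
      simp only [F, coeff_sum, coeff_monomial]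
      rw [Finset.sum_eq_single m]
      · simp
      · intro m' _ hm'
        rw [if_neg fun h => hm' (Subtype.ext h)]
      · simp
    have hF : F.IsHomogeneous d := by
      refine IsHomogeneous.sum _ _ _ fun m _ => isHomogeneous_monomial _ ?_
      have := mem_mon.1 m.2
      rw [Finsupp.degree_eq_sum]
      exact this
    let F' : homogeneousSubmodule (Fin 4) ℂ d := ⟨F, hF⟩
    have hF' : F' ≠ 0 := by
      intro h0
      have : F = 0 := congrArg Subtype.val h0
      have h1 := hcoeff m₀
      rw [this, coeff_zero] at h1
      exact right_ne_zero_of_mul hc h1.symm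
    let Y : Surface d := Projectivization.mk ℂ F' hF'
    obtain ⟨a, ha⟩ := Projectivization.exists_smul_eq_mk_rep ℂ F' hF'
    have hY : Y.form = (a : ℂ) • F := (congrArg Subtype.val ha).symm
    refine ⟨Y, ?_⟩
    change eval (fun m => coeff m Y.form) (rename Subtype.val E) ≠ 0
    rw [hev, hY]
    have h2 : (fun m : Mon d => coeff m.1 ((a : ℂ) • F)) = (a : ℂ) • c := by
      ext m
      rw [coeff_smul, hcoeff]
      rfl
    rw [h2, hEhom.eval_smul_eq]
    exact mul_ne_zero (pow_ne_zero _ a.ne_zero) (left_ne_zero_of_mul hc)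
  · intro X hX
    change eval (fun m => coeff m X.form) (rename Subtype.val E) ≠ 0 at hX
    rw [hev] at hX
    obtain ⟨s, hs, hsD⟩ := exists_smul_eval_ne_zero hX
    refine ⟨s, hs, ?_⟩
    have : (fun m : Mon d => coeff m.1 (C s * X.form)) = s • fun m : Mon d => coeff m.1 X.form := by
      ext m
      simp
    rwa [this]

theorem alongLine_C_mul (s : ℂ) (F : MvPolynomial (Fin 4) ℂ) (a b : Fin 4 → ℂ) :
    alongLine (C s * F) a b = Polynomial.C s * alongLine F a b := by
  rw [alongLine, map_mul, algHom_C]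
  rfl

/-- For a generic surface, the lines meeting it in few points satisfy many relations. -/
theorem Surface.exists_isOpen_relations {d : ℕ} (hd : 4 ≤ d) :
    ∃ U : Set (Surface d), IsOpen U ∧ U.Nonempty ∧ ∀ X ∈ U,
      (∀ L, ¬ X.ContainsLine L) ∧
      ∀ (σ : Equiv.Perm (Fin 4)), ∀ p ≤ 4, ∀ (ι : Fin p → Fin 4), 5 ≤ d + p →
          ∃ q : MvPolynomial (Fin p) ℂ, q ≠ 0 ∧ ∀ x : AffFour,
            (X.interPartition (chart σ x)).card + 5 ≤ d + p → eval (x.coord ∘ ι) q = 0 := by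
  obtain ⟨D, hD0, hD⟩ := exists_generic hd
  obtain ⟨U, hU, hUne, hUD⟩ := exists_isOpen_generic hD0
  refine ⟨U, hU, hUne, fun X hX => ?_⟩
  obtain ⟨s, hs, hsD⟩ := hUD X hX
  have hhom : (C s * X.form).IsHomogeneous d := by
    simpa using (isHomogeneous_C (Fin 4) s).mul X.form_isHomogeneous
  have hgen := hD _ hhom hsD
  have hlines : ∀ L, ¬ X.ContainsLine L := by
    intro L hL
    obtain ⟨σ, x, rfl⟩ := ProjLine.exists_chart L
    refine (hgen σ).1 x.coord ?_
    refine Polynomial.funext fun t => ?_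
    rw [eval_alongLine, map_mul, hL, mul_zero, Polynomial.eval_zero]
    exact Submodule.mem_span_pair.2 ⟨1, t, by simp⟩
  refine ⟨hlines, fun σ p hp ι hdp => ?_⟩
  obtain ⟨q, hq0, hq⟩ := (hgen σ).2 p hp ι hdp
  refine ⟨q, hq0, fun x hx => hq x.coord ?_⟩
  have h1 := card_roots_le_card_interPartition σ x (hlines _)
  rw [alongLine_C_mul, Polynomial.roots_C_mul _ hs]
  omega

/-! ### The strata of a generic surface -/

namespace Surface

variable {d : ℕ} {X : Surface d}

/-- In each chart, any `p` coordinates of the lines meeting `X` in at most `d + p - 5` points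
satisfy a nontrivial relation. -/
def HasRelations (X : Surface d) : Prop :=
  ∀ (σ : Equiv.Perm (Fin 4)), ∀ p ≤ 4, ∀ (ι : Fin p → Fin 4), 5 ≤ d + p →
    ∃ q : MvPolynomial (Fin p) ℂ, q ≠ 0 ∧ ∀ x : AffFour,
      (X.interPartition (chart σ x)).card + 5 ≤ d + p → eval (x.coord ∘ ι) q = 0

theorem card_interPartition_of_mem_stratum (hX : ∀ L, ¬ X.ContainsLine L) {s : Multiset ℕ}
    {L : ProjLine} (hL : L ∈ X.stratum s) :
    (X.interPartition L).card + s.sum = s.card + d := by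
  have h1 : X.interPartition L = withOnes d s := hL
  have h2 := (interPartition_spec (hX L)).2
  rw [h1] at h2 ⊢
  exact card_withOnes (sum_withOnes h2)

theorem exists_eq_withOnes_of_not_containsLine {L : ProjLine} (hL : ¬ X.ContainsLine L) :
    ∃ s : Multiset ℕ, (∀ n ∈ s, 2 ≤ n) ∧ X.interPartition L = withOnes d s ∧
      s.sum + (X.interPartition L).card = s.card + d :=
  exists_eq_withOnes (interPartition_spec hL).1 (interPartition_spec hL).2

/-- The case `p = 0`: a relation in no variables is a nonzero constant, so no line has defect above
`4`. -/
theorem le_card_interPartition (hrel : X.HasRelations) (L : ProjLine) :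
    d ≤ (X.interPartition L).card + 4 := by
  obtain ⟨σ, x, rfl⟩ := ProjLine.exists_chart L
  by_contra hcon
  obtain ⟨q, hq0, hq⟩ := hrel σ 0 (by omega) Fin.elim0 (by omega)
  have h1 := hq x (by omega)
  rw [eq_C_of_isEmpty q, eval_C] at h1
  rw [eq_C_of_isEmpty q, h1, C_0] at hq0
  exact hq0 rfl

/-- The case `p = 4`: the lines with at most `d - 1` points satisfy a nontrivial equation in a
chart, and any point off it gives a line with `d` points. -/
theorem stratum_zero_nonempty (hd : 4 ≤ d) (hX : ∀ L, ¬ X.ContainsLine L)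
    (hrel : X.HasRelations) : (X.stratum 0).Nonempty := by
  obtain ⟨q, hq0, hq⟩ := hrel 1 4 le_rfl id (by omega)
  obtain ⟨c, hc⟩ := exists_eval_ne_zero hq0
  refine ⟨chart 1 ⟨c⟩, ?_⟩
  have hcard : d ≤ (X.interPartition (chart 1 ⟨c⟩)).card := by
    by_contra hcon
    exact hc (hq ⟨c⟩ (by omega))
  obtain ⟨s, hs2, hs, hs3⟩ := exists_eq_withOnes_of_not_containsLine (hX (chart 1 ⟨c⟩))
  have := card_le_sum_of_two_le hs2
  have hs0 : s = 0 := Multiset.card_eq_zero.1 (by omega)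
  rw [hs0] at hs
  exact hs

theorem topologicalKrullDim_stratum_le (hd : 4 ≤ d) (hX : ∀ L, ¬ X.ContainsLine L)
    (hrel : X.HasRelations) {s : Multiset ℕ} {n : ℕ} (hn : n ≤ 3) (hs : s.card + 4 ≤ s.sum + n) :
    topologicalKrullDim (X.stratum s) ≤ n := by
  refine ProjLine.topologicalKrullDim_le_of_chart fun σ => ?_
  refine AffFour.topologicalKrullDim_le_of_relations _ n fun ι _ => ?_
  obtain ⟨q, hq0, hq⟩ := hrel σ (n + 1) (by omega) ι (by omega)
  refine ⟨q, hq0, fun x hx => ?_⟩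
  rw [AffFour.ev, eval_rename]
  refine hq x ?_
  have := card_interPartition_of_mem_stratum hX hx
  omega

theorem finite_setOf_eval_const_eq_zero {q : MvPolynomial (Fin 1) ℂ} (hq : q ≠ 0) :
    {t : ℂ | eval (fun _ => t) q = 0}.Finite := by
  let P : Polynomial ℂ := aeval (fun _ => Polynomial.X) q
  have hP : ∀ t, P.eval t = eval (fun _ => t) q := by
    intro t
    simp only [P]
    rw [aeval_def, ← Polynomial.coe_evalRingHom, hom_eval₂, eval, ← coe_eval₂Hom]
    congr 1
    refine congrArg₂ _ ?_ ?_
    · ext; simp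
    · ext i; simp
  have hP0 : P ≠ 0 := by
    intro h0
    obtain ⟨c, hc⟩ := exists_eval_ne_zero hq
    apply hc
    have hc' : c = fun _ => c 0 := by
      ext i
      rw [Subsingleton.elim i 0]
    rw [hc', ← hP, h0, Polynomial.eval_zero]
  refine (Polynomial.finite_setOfPred_isRoot hP0).subset fun t ht => ?_
  change P.eval t = 0
  rw [hP]
  exact ht

/-- The case `p = 1`: in each chart, each of the four coordinates is a root of a nonzero polynomial
in one variable. -/
theorem finite_stratum (hd : 4 ≤ d) (hX : ∀ L, ¬ X.ContainsLine L)
    (hrel : X.HasRelations) {s : Multiset ℕ} (hs : s.card + 4 ≤ s.sum) :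
    (X.stratum s).Finite := by
  have hchart : ∀ σ, (chart σ ⁻¹' X.stratum s).Finite := by
    intro σ
    have h := fun i : Fin 4 => hrel σ 1 (by omega) (fun _ => i) (by omega)
    choose q hq0 hq using h
    have hfin := Set.Finite.pi' fun i => finite_setOf_eval_const_eq_zero (hq0 i)
    refine Set.Finite.of_finite_image (f := AffFour.coord) (hfin.subset ?_)
      (fun x _ y _ h => AffFour.ext h)
    rintro _ ⟨x, hx, rfl⟩ i
    refine hq i x ?_
    have := card_interPartition_of_mem_stratum hX hx
    omega
  refine (Set.finite_iUnion fun σ => (hchart σ).image (chart σ)).subset fun L hL => ?_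
  obtain ⟨σ, x, rfl⟩ := ProjLine.exists_chart L
  exact Set.mem_iUnion.2 ⟨σ, x, hL, rfl⟩

theorem isLocallyClosedOfDim_stratum (hd : 4 ≤ d) (hX : ∀ L, ¬ X.ContainsLine L)
    (hrel : X.HasRelations) {s : Multiset ℕ} {n : ℕ} (hn : n ≤ 3) (hs : s.card + 4 = s.sum + n) :
    IsLocallyClosedOfDim (X.stratum s) n := by
  refine ⟨isLocallyClosed_stratum hX s, fun ⟨L, hL⟩ =>
    le_antisymm (topologicalKrullDim_stratum_le hd hX hrel hn hs.le) ?_⟩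
  have := le_topologicalKrullDim_stratum_inter hX hL isOpen_univ (Set.mem_univ L) (n := n)
    (by omega)
  rwa [Set.inter_univ] at this

theorem isLocallyClosedHypersurface_stratum (hd : 4 ≤ d) (hX : ∀ L, ¬ X.ContainsLine L)
    (hrel : X.HasRelations) : IsLocallyClosedHypersurface (X.stratum {2}) := by
  refine ⟨isLocallyClosed_stratum hX _, fun Z hZ => le_antisymm ?_ ?_⟩
  · exact (topologicalKrullDim_subspace_le _ Z).trans
      (topologicalKrullDim_stratum_le hd hX hrel (n := 3) le_rfl (by simp))
  -- In a Noetherian space every irreducible component contains a nonempty open set, and there the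
  -- local lower bound applies.
  · obtain ⟨o, ho, ⟨L, hLo⟩, hoZ⟩ :=
      NoetherianSpace.exists_isOpen_nonempty_subset_irreducibleComponent Z hZ
    obtain ⟨O, hO, rfl⟩ := isOpen_induced_iff.1 ho
    refine (le_topologicalKrullDim_stratum_inter hX L.2 hO hLo (n := 3) (by simp)).trans ?_
    let f : (X.stratum {2} ∩ O : Set ProjLine) → Z := fun M => ⟨⟨M.1, M.2.1⟩, hoZ M.2.2⟩
    have hf : IsInducing f := by
      rw [← (IsInducing.subtypeVal.comp IsInducing.subtypeVal :
        IsInducing ((Subtype.val : X.stratum {2} → ProjLine) ∘ (Subtype.val : Z → _))).of_comp_iff]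
      exact IsInducing.subtypeVal
    exact hf.topologicalKrullDim_le

end Surface

theorem theorem3p3 (d : ℕ) (hd : 4 ≤ d) :
    ∃ U : Set (Surface d), IsOpen U ∧ U.Nonempty ∧ ∀ X ∈ U,
      (∀ L : ProjLine, ¬ X.ContainsLine L) ∧
      (∀ L : ProjLine, ∃ s ∈ ({0, {2}, {2, 2}, {3}, {2, 2, 2}, {3, 2}, {4},
          {2, 2, 2, 2}, {3, 2, 2}, {3, 3}, {4, 2}, {5}} : Set (Multiset ℕ)),
        X.interPartition L = withOnes d s) ∧
      (IsOpen (X.stratum 0) ∧ (X.stratum 0).Nonempty) ∧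
      IsLocallyClosedHypersurface (X.stratum {2}) ∧
      IsLocallyClosedOfDim (X.stratum {2, 2}) 2 ∧
      IsLocallyClosedOfDim (X.stratum {3}) 2 ∧
      IsLocallyClosedOfDim (X.stratum {2, 2, 2}) 1 ∧
      IsLocallyClosedOfDim (X.stratum {3, 2}) 1 ∧
      IsLocallyClosedOfDim (X.stratum {4}) 1 ∧
      (X.stratum {2, 2, 2, 2}).Finite ∧
      (X.stratum {3, 2, 2}).Finite ∧
      (X.stratum {3, 3}).Finite ∧
      (X.stratum {4, 2}).Finite ∧
      (X.stratum {5}).Finite := by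
  obtain ⟨U, hU, hUne, hUX⟩ := Surface.exists_isOpen_relations hd
  refine ⟨U, hU, hUne, fun X hXU => ?_⟩
  obtain ⟨hX, hrel⟩ := hUX X hXU
  have hdim := fun (s : Multiset ℕ) (n : ℕ) =>
    Surface.isLocallyClosedOfDim_stratum hd hX hrel (s := s) (n := n)
  have hfin := fun (s : Multiset ℕ) => Surface.finite_stratum hd hX hrel (s := s)
  refine ⟨hX, fun L => ?_, ⟨Surface.isOpen_stratum_zero hX,
    Surface.stratum_zero_nonempty hd hX hrel⟩,
    Surface.isLocallyClosedHypersurface_stratum hd hX hrel, hdim _ _ (by omega) (by simp),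
    hdim _ _ (by omega) (by simp), hdim _ _ (by omega) (by simp), hdim _ _ (by omega) (by simp),
    hdim _ _ (by omega) (by simp), hfin _ (by simp), hfin _ (by simp), hfin _ (by simp),
    hfin _ (by simp), hfin _ (by simp)⟩
  obtain ⟨s, hs2, hs, hs3⟩ := Surface.exists_eq_withOnes_of_not_containsLine (hX L)
  have := Surface.le_card_interPartition hrel L
  exact ⟨s, mem_list_of_sum_le hs2 (by omega), hs⟩
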